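/- **Theorem 1.** Let $d,T\ge 1$ be integers and let $\mathcal X\subset\mathbb R^d$ be a closed set with $\|x\|\le 1$ for all $x\in\mathcal X$. Let $\theta^\star\in\mathbb R^d$ with $\|\theta^\star\|\le S$, where $S\ge 0$ is known, and let $x^\star\in\arg\max_{x\in\mathcal X}x^{\mathsf T}\theta^\star$. At each step $t=1,\dots,T$ a learner picks an arm $x_t\in\mathcal X$ and observes $r_{t+1}=x_t^{\mathsf T}\theta^\star+\xi_{t+1}$. Let $\mathcal F_1$ be a $\sigma$-algebra (prior information), let $\mathcal F_t=\sigma(\mathcal F_1,x_1,r_2,\dots,x_{t-1},r_t)$ and $\mathcal F^x_t=\sigma(\mathcal F_t,x_t)$, and suppose that the noise satisfies, for some $R\ge0$ and all $t$, $\mathbb E[\xi_{t+1}\mid\mathcal F^x_t]=0$ and $\mathbb E[e^{\alpha\xi_{t+1}}\mid\mathcal F^x_t]\le e^{\alpha^2R^2/2}$ for all $\alpha\in\mathbb R$. Let $\lambda\ge 1$, $\delta\in(0,1)$, $\delta'=\delta/(4T)$, and put $$V_t=\lambda I+\sum_{s=1}^{t-1}x_sx_s^{\mathsf T},\qquad \hat\theta_t=V_t^{-1}\sum_{s=1}^{t-1}x_sr_{s+1},\qquad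 \beta_t(\delta')=R\sqrt{2\log\frac{(\lambda+t)^{d/2}\lambda^{-d/2}}{\delta'}}+\sqrt\lambda\,S .$$ Let $\mathcal D$ be a probability distribution on $\mathbb R^d$, absolutely continuous with respect to Lebesgue measure, and $p,c,c'>0$ constants such that $\mathbb P_{\eta\sim\mathcal D}(u^{\mathsf T}\eta\ge 1)\ge p$ for every $u$ with $\|u\|=1$ (anti-concentration) and $\mathbb P_{\eta\sim\mathcal D}\big(\|\eta\|\le\sqrt{cd\log(c'd/\epsilon)}\big)\ge 1-\epsilon$ for every $\epsilon\in(0,1)$ (concentration). Put $\gamma_t(\delta')=\beta_t(\delta')\sqrt{cd\log(c'd/\delta')}$. Suppose that the arms are chosen by linear Thompson sampling: at each step $t=1,\dots,T$ a sample $\eta_t\sim\mathcal D$ is drawn independently of $\mathcal F_t$, and $x_t\in\arg\max_{x\in\mathcal X}x^{\mathsf T}\tilde\theta_t$, where $\tilde\theta_t=\hat\theta_t+\beta_t(\delta')V_t^{-1/2}\eta_t$ (ties broken arbitrarily). Then the regret $R(T)=\sum_{t=1}^T\big(x^{\star\mathsf T}\theta^\star-x_t^{\mathsf T}\theta^\star\big)$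 satisfies, with probability at least $1-\delta$, $$R(T)\le\Big(\beta_T(\delta')+\gamma_T(\delta')\big(1+\tfrac4p\big)\Big)\sqrt{2Td\log\Big(1+\frac T\lambda\Big)}+\frac{4\gamma_T(\delta')}{p}\sqrt{\frac{8T}{\lambda}\log\frac4\delta}.$$ The right-hand side is of order $\tilde O(d^{3/2}\sqrt T)$: there are a constant $C>0$ and an integer $k\ge 0$, depending only on $R,S,\lambda,p,c,c'$, such that for all $d,T\ge1$ and $\delta\in(0,1)$ it is at most $C\,d^{3/2}\sqrt T\,\big(\log(e\,d\,T/\delta)\big)^k$. -/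

import Mathlib

open MeasureTheory ProbabilityTheory

noncomputable section

namespace LinTS

/-- Vectors of `ℝ^d` with the Euclidean norm. -/
abbrev Vec (d : ℕ) : Type := EuclideanSpace ℝ (Fin d)

/-- `x` is an optimal arm for the parameter `θ`: it maximizes `y ↦ yᵀθ` over the arm set. -/
def IsOptimalArm {d : ℕ} (X : Set (Vec d)) (θ x : Vec d) : Prop :=
  x ∈ X ∧ ∀ y ∈ X, inner ℝ y θ ≤ inner ℝ x θ

/-- The design matrix `V_t = λ I + ∑_{s=1}^{t-1} x_s x_sᵀ`. -/
def designMatrix {d : ℕ} (lam : ℝ) (x : ℕ → Vec d) (t : ℕ) : Matrix (Fin d) (Fin d) ℝ :=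
  lam • (1 : Matrix (Fin d) (Fin d) ℝ) +
    ∑ s ∈ Finset.Ico 1 t, Matrix.vecMulVec (x s).ofLp (x s).ofLp

/-- The regularized least-squares estimate `V_t⁻¹ ∑_{s=1}^{t-1} r_{s+1} x_s`. -/
def rlsEstimate {d : ℕ} (lam : ℝ) (x : ℕ → Vec d) (r : ℕ → ℝ) (t : ℕ) : Vec d :=
  WithLp.toLp 2 (Matrix.mulVec (designMatrix lam x t)⁻¹
    (∑ s ∈ Finset.Ico 1 t, r (s + 1) • (x s).ofLp))

/-- The symmetric inverse square root `V^{-1/2}` of a symmetric positive definite matrix,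
by functional calculus. -/
def invSqrt {d : ℕ} (V : Matrix (Fin d) (Fin d) ℝ) : Matrix (Fin d) (Fin d) ℝ :=
  cfc (fun v : ℝ => (Real.sqrt v)⁻¹) V

/-- The radius `β_t(δ)` of the least-squares confidence ellipsoid. -/
def beta (R S lam : ℝ) (d t : ℕ) (δ : ℝ) : ℝ :=
  R * Real.sqrt (2 * Real.log ((lam + t) ^ ((d : ℝ) / 2) * lam ^ (-((d : ℝ) / 2)) / δ))
    + Real.sqrt lam * S

/-- The radius `γ_t(δ)` of the sampling ellipsoid, at the confidence level that also enters
`β_t`. -/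
def gamma (R S lam c c' : ℝ) (d t : ℕ) (δ : ℝ) : ℝ :=
  beta R S lam d t δ * Real.sqrt (c * d * Real.log (c' * d / δ))

/-- The perturbed parameter `θ̂_t + β_t(δ') V_t^{-1/2} η_t`. -/
def perturbed {d : ℕ} (R S lam δ' : ℝ) (x : ℕ → Vec d) (r : ℕ → ℝ) (η : Vec d) (t : ℕ) :
    Vec d :=
  rlsEstimate lam x r t +
    beta R S lam d t δ' •
      WithLp.toLp 2 (Matrix.mulVec (invSqrt (designMatrix lam x t)) η.ofLp)

/-- An admissible sampling distribution for Thompson sampling, with anti-concentration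
probability `p` and concentration constants `c`, `c'`. -/
structure IsTSDistribution {d : ℕ} (D : Measure (Vec d)) (p c c' : ℝ) : Prop where
  isProbabilityMeasure : IsProbabilityMeasure D
  absolutelyContinuous : D ≪ volume
  p_pos : 0 < p
  c_pos : 0 < c
  c'_pos : 0 < c'
  anti_concentration : ∀ u : Vec d, ‖u‖ = 1 → p ≤ D.real {η | 1 ≤ inner ℝ u η}
  concentration : ∀ δ : ℝ, 0 < δ → δ < 1 →
    1 - δ ≤ D.real {η | ‖η‖ ≤ Real.sqrt (c * d * Real.log (c' * d / δ))}

/-- The information before sampling at step `t`: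
`F_t = σ(F_1, x_1, r_2, x_2, r_3, …, x_{t-1}, r_t)`. -/
abbrev history {Ω : Type*} {d : ℕ} (F1 : MeasurableSpace Ω) (x : ℕ → Ω → Vec d)
    (r : ℕ → Ω → ℝ) (t : ℕ) : MeasurableSpace Ω :=
  F1 ⊔ ⨆ s ∈ Finset.Ico 1 t,
    (MeasurableSpace.comap (x s) inferInstance ⊔
      MeasurableSpace.comap (r (s + 1)) inferInstance)

/-- The information after the choice of the arm at step `t`:
`F^x_t = σ(F_1, x_1, r_2, …, r_t, x_t)`. -/
abbrev historyArm {Ω : Type*} {d : ℕ} (F1 : MeasurableSpace Ω) (x : ℕ → Ω → Vec d)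
    (r : ℕ → Ω → ℝ) (t : ℕ) : MeasurableSpace Ω :=
  history F1 x r t ⊔ MeasurableSpace.comap (x t) inferInstance

/-- The stochastic linear bandit up to step `T`: rewards `r_{t+1} = x_tᵀθ⋆ + ξ_{t+1}`, where
the noise is a martingale difference sequence and conditionally `R`-subgaussian given
`F^x_t`. -/
structure IsLinearBandit {Ω : Type*} (F1 : MeasurableSpace Ω) [mΩ : MeasurableSpace Ω]
    (μ : Measure Ω) {d : ℕ} (θstar : Vec d) (R : ℝ) (T : ℕ)
    (x : ℕ → Ω → Vec d) (r ξ : ℕ → Ω → ℝ) : Prop where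
  measurable_arm : ∀ t, 1 ≤ t → t ≤ T → Measurable[mΩ] (x t)
  measurable_noise : ∀ t, 1 ≤ t → t ≤ T → Measurable[mΩ] (ξ (t + 1))
  reward_eq : ∀ t, 1 ≤ t → t ≤ T → ∀ ω, r (t + 1) ω = inner ℝ (x t ω) θstar + ξ (t + 1) ω
  integrable_noise : ∀ t, 1 ≤ t → t ≤ T → Integrable (ξ (t + 1)) μ
  noise_mean_zero : ∀ t, 1 ≤ t → t ≤ T → μ[ξ (t + 1) | historyArm F1 x r t] =ᵐ[μ] 0
  integrable_exp_noise : ∀ t, 1 ≤ t → t ≤ T → ∀ α : ℝ,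
    Integrable (fun ω => Real.exp (α * ξ (t + 1) ω)) μ
  noise_subgaussian : ∀ t, 1 ≤ t → t ≤ T → ∀ α : ℝ,
    μ[fun ω => Real.exp (α * ξ (t + 1) ω) | historyArm F1 x r t]
      ≤ᵐ[μ] fun _ => Real.exp (α ^ 2 * R ^ 2 / 2)

/-- The arms `x_1, …, x_T` are chosen by linear Thompson sampling at confidence `δ' = δ/(4T)`:
at step `t` a fresh sample `η_t ∼ D`, independent of the past information, is drawn, and `x_t`
is an optimal arm (ties broken arbitrarily) for the perturbed parameter. -/
structure IsThompsonSampling {Ω : Type*} (F1 : MeasurableSpace Ω) [mΩ : MeasurableSpace Ω]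
    (μ : Measure Ω) {d : ℕ} (X : Set (Vec d)) (D : Measure (Vec d)) (R S lam δ : ℝ) (T : ℕ)
    (x : ℕ → Ω → Vec d) (r : ℕ → Ω → ℝ) (η : ℕ → Ω → Vec d) : Prop where
  measurable_sample : ∀ t, 1 ≤ t → t ≤ T → Measurable[mΩ] (η t)
  law_sample : ∀ t, 1 ≤ t → t ≤ T → Measure.map (η t) μ = D
  indep_sample : ∀ t, 1 ≤ t → t ≤ T →
    Indep (MeasurableSpace.comap (η t) inferInstance) (history F1 x r t) μ
  arm_optimal : ∀ t, 1 ≤ t → t ≤ T → ∀ ω,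
    IsOptimalArm X
      (perturbed R S lam (δ / (4 * T)) (fun s => x s ω) (fun s => r s ω) (η t ω) t) (x t ω)

/-- The cumulative regret `∑_{t=1}^T (x⋆ᵀθ⋆ - x_tᵀθ⋆)`. -/
def regret {d : ℕ} (θstar xstar : Vec d) (x : ℕ → Vec d) (T : ℕ) : ℝ :=
  ∑ t ∈ Finset.Icc 1 T, (inner ℝ xstar θstar - inner ℝ (x t) θstar)

/-- The regret bound, with `δ' = δ/(4T)`. -/
def regretBound (R S lam p c c' : ℝ) (d T : ℕ) (δ : ℝ) : ℝ :=
  (beta R S lam d T (δ / (4 * T)) + gamma R S lam c c' d T (δ / (4 * T)) * (1 + 4 / p))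
      * Real.sqrt (2 * T * d * Real.log (1 + T / lam))
    + 4 * gamma R S lam c c' d T (δ / (4 * T)) / p
      * Real.sqrt (8 * T / lam * Real.log (4 / δ))

end LinTS

end

/-! ### Linear algebra of the design matrix and the elliptical potential. -/

noncomputable section
namespace LinTS
open Matrix

/-! Write `W = V_t^{-1/2}` and `J(θ) = sup_{y ∈ X} yᵀθ`. The regret at step `t` splits as `(J(θ⋆) -
x_tᵀθ̃_t) + (x_tᵀθ̃_t - x_tᵀθ⋆)`. On the event that `θ⋆` lies in the confidence ellipsoid and `η_t`
in its concentration ball, the second bracket is at most `(β + γ)‖W x_t‖` by Cauchy–Schwarz.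

The first bracket needs optimism. If the sample satisfies `‖W x⋆‖ ≤ ⟨W x⋆, η_t⟩`, then `x_tᵀθ̃_t ≥
J(θ⋆)`, and moving the perturbation anywhere else in the ball costs at most `2γ‖W x_t‖`. So the
worst optimism gap over the ball, which is known before sampling, is at most `2γ‖W x_t‖` whenever
the fresh sample is optimistic. By independence and anti-concentration this has conditional
probability at least `p - δ' ≥ p/2`; averaging gives a gap of at most `(4γ/p) E[‖W x_t‖ | F_t]`
(`ae_optValue_sub_inner_perturbed_le`). No differentiability or convexity of `J` enters.

Azuma–Hoeffding (`measure_compensatedSum_ge_le`) replaces the conditional expectations by `‖W x_t‖`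
itself, and Cauchy–Schwarz with the elliptical potential lemma (`sum_norm_whiten_sq_le`) bounds the
sum. The confidence ellipsoid comes from a self-normalized process of expectation at most one
(`lintegral_selfNormalized_le_one`), built one step at a time by mixing a scalar exponent over a
Gaussian.

If `δ' > p/2` the optimism argument is unavailable, but then `2Tp ≤ 1` and the trivial bound `2TS`
already lies below the claimed one (`crude_le_regretBound`). -/

lemma inner_eq_dotProduct {d : ℕ} (x y : Vec d) : inner ℝ x y = x.ofLp ⬝ᵥ y.ofLp := by
  rw [EuclideanSpace.inner_eq_star_dotProduct, dotProduct_comm]; simp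

lemma dotProduct_self_eq_norm_sq {d : ℕ} (x : Vec d) : x.ofLp ⬝ᵥ x.ofLp = ‖x‖ ^ 2 := by
  rw [← inner_eq_dotProduct, real_inner_self_eq_norm_sq]

lemma designMatrix_one {d : ℕ} (lam : ℝ) (x : ℕ → Vec d) : designMatrix lam x 1 = lam • 1 := by
  simp [designMatrix]

lemma designMatrix_succ {d : ℕ} (lam : ℝ) (x : ℕ → Vec d) {t : ℕ} (ht : 1 ≤ t) :
    designMatrix lam x (t + 1) = designMatrix lam x t + vecMulVec (x t).ofLp (x t).ofLp := by
  simp only [designMatrix, Finset.sum_Ico_succ_top ht, add_assoc]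

lemma designMatrix_isHermitian {d : ℕ} (lam : ℝ) (x : ℕ → Vec d) (t : ℕ) :
    (designMatrix lam x t).IsHermitian := by
  ext i j
  simp [designMatrix, Matrix.sum_apply, vecMulVec_apply, mul_comm, Matrix.one_apply, eq_comm]

lemma dotProduct_designMatrix_mulVec {d : ℕ} (lam : ℝ) (x : ℕ → Vec d) (t : ℕ) (v : Fin d → ℝ) :
    v ⬝ᵥ designMatrix lam x t *ᵥ v
      = lam * (v ⬝ᵥ v) + ∑ s ∈ Finset.Ico 1 t, ((x s).ofLp ⬝ᵥ v) ^ 2 := by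
  simp only [designMatrix, add_mulVec, smul_mulVec, one_mulVec, dotProduct_add, dotProduct_smul,
    smul_eq_mul, sum_mulVec, dotProduct_sum]
  congr 1
  refine Finset.sum_congr rfl fun s _ => ?_
  simp [vecMulVec_mulVec, dotProduct_comm v, pow_two]

lemma designMatrix_posDef {d : ℕ} {lam : ℝ} (hlam : 0 < lam) (x : ℕ → Vec d) (t : ℕ) :
    (designMatrix lam x t).PosDef := by
  refine Matrix.PosDef.of_dotProduct_mulVec_pos (designMatrix_isHermitian lam x t) fun v hv => ?_
  simp only [star_trivial]
  rw [dotProduct_designMatrix_mulVec]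
  have h1 : 0 < v ⬝ᵥ v := by
    simpa using (dotProduct_star_self_pos_iff (v := v)).2 hv
  have h2 : 0 ≤ ∑ s ∈ Finset.Ico 1 t, ((x s).ofLp ⬝ᵥ v) ^ 2 :=
    Finset.sum_nonneg fun _ _ => sq_nonneg _
  positivity

lemma designMatrix_mul_inv {d : ℕ} {lam : ℝ} (hlam : 0 < lam) (x : ℕ → Vec d) (t : ℕ) :
    designMatrix lam x t * (designMatrix lam x t)⁻¹ = 1 :=
  Matrix.mul_nonsing_inv _ (designMatrix_posDef hlam x t).det_pos.ne'.isUnit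

/-- Rank-one update of the determinant. -/
lemma det_add_vecMulVec_self {n : Type*} [Fintype n] [DecidableEq n] {V : Matrix n n ℝ}
    (hV : IsUnit V.det) (x : n → ℝ) :
    (V + vecMulVec x x).det = V.det * (1 + x ⬝ᵥ V⁻¹ *ᵥ x) := by
  have h := det_add_replicateCol_mul_replicateRow hV x x (ι := Unit)
  rw [vecMulVec_eq Unit, h]
  congr 1
  rw [det_unique]
  simp [Matrix.mul_apply, dotProduct, mulVec, Finset.mul_sum, mul_comm]
  rw [Finset.sum_comm]
  refine Finset.sum_congr rfl fun i _ => Finset.sum_congr rfl fun j _ => by ring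

/-- Rank-one update of the inverse quadratic form (Sherman–Morrison). -/
lemma dotProduct_inv_add_vecMulVec_self {n : Type*} [Fintype n] [DecidableEq n]
    {V : Matrix n n ℝ} (hsymm : Vᵀ = V) (hV : IsUnit V.det) (x y : n → ℝ)
    (hw : 1 + x ⬝ᵥ V⁻¹ *ᵥ x ≠ 0) :
    y ⬝ᵥ (V + vecMulVec x x)⁻¹ *ᵥ y
      = y ⬝ᵥ V⁻¹ *ᵥ y - (x ⬝ᵥ V⁻¹ *ᵥ y) ^ 2 / (1 + x ⬝ᵥ V⁻¹ *ᵥ x) := by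
  have hU : IsUnit (V + vecMulVec x x).det := by
    rw [det_add_vecMulVec_self hV]; exact hV.mul hw.isUnit
  set w := x ⬝ᵥ V⁻¹ *ᵥ x
  set b := x ⬝ᵥ V⁻¹ *ᵥ y
  have hVV : ∀ z, V *ᵥ V⁻¹ *ᵥ z = z := fun z => by
    rw [mulVec_mulVec, mul_nonsing_inv _ hV, one_mulVec]
  have key : (V + vecMulVec x x)⁻¹ *ᵥ y = V⁻¹ *ᵥ y - (b / (1 + w)) • V⁻¹ *ᵥ x := by
    have : y = (V + vecMulVec x x) *ᵥ (V⁻¹ *ᵥ y - (b / (1 + w)) • V⁻¹ *ᵥ x) := by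
      have e1 : x ⬝ᵥ (V⁻¹ *ᵥ y - (b / (1 + w)) • V⁻¹ *ᵥ x) = b - b / (1 + w) * w := by
        rw [dotProduct_sub, dotProduct_smul, smul_eq_mul]
      rw [add_mulVec, mulVec_sub, mulVec_smul, hVV, hVV, vecMulVec_mulVec, e1]
      have e2 : b - b / (1 + w) * w = b / (1 + w) := by field_simp; ring
      rw [e2]; ext i; simp; ring
    conv_lhs => rw [this]
    rw [mulVec_mulVec, nonsing_inv_mul _ hU, one_mulVec]
  have hb : y ⬝ᵥ V⁻¹ *ᵥ x = b := by
    rw [dotProduct_mulVec, ← mulVec_transpose, transpose_nonsing_inv, hsymm, dotProduct_comm]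
  rw [key, dotProduct_sub, dotProduct_smul, hb, smul_eq_mul]
  ring

lemma invSqrt_transpose {d : ℕ} (V : Matrix (Fin d) (Fin d) ℝ) : (invSqrt V)ᵀ = invSqrt V := by
  have : IsSelfAdjoint (invSqrt V) := cfc_predicate _ V
  simpa [IsSelfAdjoint, star_eq_conjTranspose] using this

/-- A matrix has finite spectrum, so every function is continuous on it and the calculus is
multiplicative; positivity of the eigenvalues keeps the root away from its junk value at `0`. -/
lemma invSqrt_mul_self {d : ℕ} {V : Matrix (Fin d) (Fin d) ℝ} (hV : V.PosDef) :
    invSqrt V * invSqrt V = V⁻¹ := by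
  have hfin : (spectrum ℝ V).Finite := Matrix.finite_real_spectrum
  have hsa : IsSelfAdjoint V := hV.isHermitian
  have h : V * (invSqrt V * invSqrt V) = 1 := by
    unfold invSqrt
    rw [← cfc_mul _ _ V (hfin.continuousOn _) (hfin.continuousOn _)]
    nth_rewrite 1 [← cfc_id ℝ V]
    rw [← cfc_mul _ _ V (hfin.continuousOn _) (hfin.continuousOn _), ← cfc_one ℝ V]
    refine cfc_congr fun v hv => ?_
    have hpos : 0 < v := by
      rw [hV.isHermitian.spectrum_real_eq_range_eigenvalues] at hv
      obtain ⟨i, rfl⟩ := hv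
      exact hV.eigenvalues_pos i
    have h1 := Real.mul_self_sqrt hpos.le
    have h2 := Real.sqrt_pos.2 hpos
    simp only [id, Pi.one_apply]
    rw [← mul_inv, h1]; field_simp
  exact (inv_eq_right_inv h).symm

/-- The vector `V^{-1/2} v`. -/
def whiten {d : ℕ} (V : Matrix (Fin d) (Fin d) ℝ) : Vec d →ₗ[ℝ] Vec d :=
  Matrix.toEuclideanLin (invSqrt V)

lemma whiten_apply {d : ℕ} (V : Matrix (Fin d) (Fin d) ℝ) (v : Vec d) :
    whiten V v = WithLp.toLp 2 (invSqrt V *ᵥ v.ofLp) := rfl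

lemma inner_whiten {d : ℕ} (V : Matrix (Fin d) (Fin d) ℝ) (v w : Vec d) :
    inner ℝ v (whiten V w) = inner ℝ (whiten V v) w := by
  simp only [inner_eq_dotProduct, whiten_apply]
  rw [dotProduct_mulVec, ← mulVec_transpose, invSqrt_transpose]

lemma whiten_whiten {d : ℕ} {V : Matrix (Fin d) (Fin d) ℝ} (hV : V.PosDef) (v : Vec d) :
    whiten V (whiten V v) = WithLp.toLp 2 (V⁻¹ *ᵥ v.ofLp) := by
  simp only [whiten_apply]
  rw [mulVec_mulVec, invSqrt_mul_self hV]

lemma norm_whiten_sq {d : ℕ} {V : Matrix (Fin d) (Fin d) ℝ} (hV : V.PosDef) (v : Vec d) :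
    ‖whiten V v‖ ^ 2 = v.ofLp ⬝ᵥ V⁻¹ *ᵥ v.ofLp := by
  rw [← real_inner_self_eq_norm_sq, ← inner_whiten, whiten_whiten hV, inner_eq_dotProduct]

/-- This is `V ≥ λI` in inverse form. For `y = V⁻¹v` one has `λ‖y‖² ≤ ⟨v, y⟩ ≤ ‖v‖‖y‖`, and `⟨v, y⟩`
is the squared left-hand side. -/
lemma norm_whiten_designMatrix_le {d : ℕ} {lam : ℝ} (hlam : 0 < lam) (x : ℕ → Vec d) (t : ℕ)
    (v : Vec d) : ‖whiten (designMatrix lam x t) v‖ ≤ ‖v‖ / √lam := by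
  set V := designMatrix lam x t with hVdef
  have hV : V.PosDef := designMatrix_posDef hlam x t
  set y : Vec d := WithLp.toLp 2 (V⁻¹ *ᵥ v.ofLp) with hy
  have hVy : V *ᵥ y.ofLp = v.ofLp := by
    rw [hy, mulVec_mulVec, designMatrix_mul_inv hlam, one_mulVec]
  have h1 : ‖whiten V v‖ ^ 2 = inner ℝ v y := by
    rw [norm_whiten_sq hV, inner_eq_dotProduct]
  have h2 : lam * ‖y‖ ^ 2 ≤ inner ℝ v y := by
    rw [inner_eq_dotProduct, dotProduct_comm, ← hVy, dotProduct_designMatrix_mulVec,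
      dotProduct_self_eq_norm_sq]
    have : 0 ≤ ∑ s ∈ Finset.Ico 1 t, ((x s).ofLp ⬝ᵥ y.ofLp) ^ 2 :=
      Finset.sum_nonneg fun _ _ => sq_nonneg _
    linarith
  have h3 : inner ℝ v y ≤ ‖v‖ * ‖y‖ := real_inner_le_norm v y
  have h4 : lam * ‖y‖ ≤ ‖v‖ := by
    rcases (norm_nonneg y).eq_or_lt with h | h
    · rw [← h]; simp
    · nlinarith
  refine abs_le_of_sq_le_sq' ?_ (by positivity) |>.2
  rw [h1, div_pow, Real.sq_sqrt hlam.le, le_div_iff₀ hlam]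
  nlinarith [norm_nonneg v]

/-- Each eigenvalue is the quadratic form at a unit eigenvector, to which every unit-ball arm
contributes at most one. This is cruder than the trace–determinant inequality but sufficient for
`beta`. -/
lemma det_designMatrix_le {d : ℕ} {lam : ℝ} (hlam : 0 < lam) (x : ℕ → Vec d) (t : ℕ)
    (hx : ∀ s ∈ Finset.Ico 1 t, ‖x s‖ ≤ 1) :
    (designMatrix lam x t).det ≤ (lam + (t - 1 : ℕ)) ^ d := by
  have hH := designMatrix_isHermitian lam x t
  rw [hH.det_eq_prod_eigenvalues]
  simp only [RCLike.ofReal_real_eq_id, id]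
  have hb : ∀ i, hH.eigenvalues i ≤ lam + (t - 1 : ℕ) := by
    intro i
    have h1 := hH.eigenvalues_eq i
    simp only [star_trivial, RCLike.re_to_real] at h1
    have hn : ‖hH.eigenvectorBasis i‖ = 1 := hH.eigenvectorBasis.orthonormal.1 i
    rw [h1, dotProduct_designMatrix_mulVec, dotProduct_self_eq_norm_sq, hn]
    have : ∑ s ∈ Finset.Ico 1 t, ((x s).ofLp ⬝ᵥ (hH.eigenvectorBasis i).ofLp) ^ 2
        ≤ ∑ s ∈ Finset.Ico 1 t, (1:ℝ) := by
      refine Finset.sum_le_sum fun s hs => ?_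
      rw [← inner_eq_dotProduct]
      have := abs_real_inner_le_norm (x s) (hH.eigenvectorBasis i)
      rw [hn, mul_one] at this
      rw [← sq_abs]
      exact pow_le_one₀ (abs_nonneg _) (this.trans (hx s hs))
    simp at this
    linarith
  calc ∏ i, hH.eigenvalues i ≤ ∏ _i : Fin d, (lam + (t - 1 : ℕ)) :=
        Finset.prod_le_prod (fun i _ => (designMatrix_posDef hlam x t).eigenvalues_pos i |>.le)
          fun i _ => hb i
    _ = _ := by simp

lemma le_two_mul_log_one_add {w : ℝ} (h0 : 0 ≤ w) (h1 : w ≤ 1) : w ≤ 2 * Real.log (1 + w) := by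
  have h := Real.one_sub_inv_le_log_of_pos (show 0 < 1 + w by linarith)
  have : w / 2 ≤ 1 - (1 + w)⁻¹ := by
    rw [show 1 - (1 + w)⁻¹ = w / (1 + w) by field_simp; ring]
    exact div_le_div_of_nonneg_left h0 (by linarith) (by linarith)
  linarith

lemma det_designMatrix_succ {d : ℕ} {lam : ℝ} (hlam : 0 < lam) (x : ℕ → Vec d) {t : ℕ}
    (ht : 1 ≤ t) :
    (designMatrix lam x (t + 1)).det
      = (designMatrix lam x t).det * (1 + ‖whiten (designMatrix lam x t) (x t)‖ ^ 2) := by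
  have hV := designMatrix_posDef hlam x t
  rw [designMatrix_succ lam x ht, det_add_vecMulVec_self hV.det_pos.ne'.isUnit, norm_whiten_sq hV]

/-- The elliptical potential lemma. -/
lemma sum_norm_whiten_sq_le {d : ℕ} {lam : ℝ} (hlam : 1 ≤ lam) (x : ℕ → Vec d) (T : ℕ)
    (hx : ∀ s ∈ Finset.Icc 1 T, ‖x s‖ ≤ 1) :
    ∑ t ∈ Finset.Icc 1 T, ‖whiten (designMatrix lam x t) (x t)‖ ^ 2
      ≤ 2 * d * Real.log (1 + T / lam) := by
  have hlam0 : 0 < lam := by linarith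
  have hdet : ∀ t, 0 < (designMatrix lam x t).det := fun t => (designMatrix_posDef hlam0 x t).det_pos
  -- The rank-one determinant formula makes the logarithms telescope from `V_1 = λI`.
  have hlog : ∀ n, ∑ t ∈ Finset.Icc 1 n,
      Real.log (1 + ‖whiten (designMatrix lam x t) (x t)‖ ^ 2)
        = Real.log (designMatrix lam x (n + 1)).det - d * Real.log lam := by
    intro n
    induction n with
    | zero => simp [designMatrix_one]
    | succ n ih =>
      rw [Finset.sum_Icc_succ_top (by omega), ih, det_designMatrix_succ hlam0 x (t := n + 1) (by omega),
        Real.log_mul (hdet _).ne' (by positivity)]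
      ring
  have h1 : ∑ t ∈ Finset.Icc 1 T, ‖whiten (designMatrix lam x t) (x t)‖ ^ 2
      ≤ 2 * ∑ t ∈ Finset.Icc 1 T, Real.log (1 + ‖whiten (designMatrix lam x t) (x t)‖ ^ 2) := by
    rw [Finset.mul_sum]
    -- Here `λ ≥ 1` matters: it puts every summand in `[0, 1]`, where `w ≤ 2 log (1 + w)`.
    refine Finset.sum_le_sum fun t ht => le_two_mul_log_one_add (sq_nonneg _) ?_
    refine pow_le_one₀ (norm_nonneg _) ((norm_whiten_designMatrix_le hlam0 x t _).trans ?_)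
    rw [div_le_one (by positivity)]
    exact (hx t ht).trans (by simpa using Real.sqrt_le_sqrt hlam)
  have h2 : Real.log (designMatrix lam x (T + 1)).det ≤ d * Real.log (lam + T) := by
    have := det_designMatrix_le hlam0 x (T + 1) fun s hs => hx s (by simp at hs ⊢; omega)
    rw [← Real.log_pow]
    exact Real.log_le_log (hdet _) (by simpa using this)
  have h3 : Real.log (1 + T / lam) = Real.log (lam + T) - Real.log lam := by
    rw [← Real.log_div (by positivity) (by positivity)]; congr 1; field_simp
  rw [hlog] at h1
  rw [h3]
  linarith

end LinTS
end

/-! ### Measurability of the estimator and of the inverse square root. -/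

noncomputable section
namespace LinTS
open Matrix Filter Topology

section Measurability

variable {Ω : Type*} {m : MeasurableSpace Ω}

lemma measurable_det {n : Type*} [Fintype n] [DecidableEq n] {A : Ω → Matrix n n ℝ}
    (hA : ∀ i j, Measurable[m] fun ω => A ω i j) : Measurable[m] fun ω => (A ω).det := by
  simp only [det_apply]
  refine Finset.measurable_sum _ fun σ _ => ?_
  simp only [Units.smul_def, zsmul_eq_mul]
  exact (Finset.measurable_prod _ fun i _ => hA _ _).const_mul _

lemma measurable_matrix_inv {n : Type*} [Fintype n] [DecidableEq n] {A : Ω → Matrix n n ℝ}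
    (hA : ∀ i j, Measurable[m] fun ω => A ω i j) (i j : n) :
    Measurable[m] fun ω => (A ω)⁻¹ i j := by
  simp only [inv_def, Ring.inverse_eq_inv', Matrix.smul_apply, smul_eq_mul, Matrix.adjugate_apply]
  refine (measurable_det hA).inv.mul (measurable_det fun k l => ?_)
  by_cases h : k = j
  · subst h; simp
  · simpa [updateRow_ne h] using hA k l

lemma measurable_matrix_pow {n : Type*} [Fintype n] [DecidableEq n] {A : Ω → Matrix n n ℝ}
    (hA : ∀ i j, Measurable[m] fun ω => A ω i j) (k : ℕ) (i j : n) :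
    Measurable[m] fun ω => (A ω ^ k) i j := by
  induction k generalizing i j with
  | zero => simp
  | succ k ih =>
    simp only [pow_succ, mul_apply]
    exact Finset.measurable_sum _ fun l _ => (ih i l).mul (hA l j)

/-- The entries are pointwise limits of entries of polynomials in the matrix, and those are plainly
measurable. -/
lemma measurable_invSqrt {d : ℕ} {A : Ω → Matrix (Fin d) (Fin d) ℝ}
    (hA : ∀ i j, Measurable[m] fun ω => A ω i j) (hpos : ∀ ω, (A ω).PosDef) (i j : Fin d) :
    Measurable[m] fun ω => invSqrt (A ω) i j := by
  -- The intervals `[1/(n+1), n+1]` exhaust `(0, ∞)`, so each finite positive spectrum is eventually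
  -- inside; one polynomial sequence thus serves all `ω`.
  have hq : ∀ n : ℕ, ∃ q : Polynomial ℝ, ∀ v ∈ Set.Icc ((n + 1 : ℝ)⁻¹) (n + 1),
      |q.eval v - (√v)⁻¹| < (n + 1 : ℝ)⁻¹ := fun n => by
    refine exists_polynomial_near_of_continuousOn _ _ _ ?_ _ (by positivity)
    refine (Real.continuous_sqrt.continuousOn).inv₀ fun v hv => ?_
    have : (0:ℝ) < (n + 1 : ℝ)⁻¹ := by positivity
    exact (Real.sqrt_pos.2 (this.trans_le hv.1)).ne'
  choose q hq using hq
  have hlim : ∀ ω, Tendsto (fun n => Polynomial.aeval (A ω) (q n)) atTop (𝓝 (invSqrt (A ω))) := by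
    intro ω
    have hsa : IsSelfAdjoint (A ω) := (hpos ω).isHermitian
    simp only [← fun n => cfc_polynomial (q n) (A ω) hsa]
    have hfin : (spectrum ℝ (A ω)).Finite := Matrix.finite_real_spectrum
    refine tendsto_cfc_fun ?_ (Eventually.of_forall fun n => hfin.continuousOn _)
    rw [Metric.tendstoUniformlyOn_iff]
    intro ε hε
    have h0 : Tendsto (fun n : ℕ => ((n : ℝ) + 1)⁻¹) atTop (𝓝 0) :=
      tendsto_inv_atTop_zero.comp (tendsto_natCast_atTop_atTop.atTop_add tendsto_const_nhds)
    refine (hfin.eventually_all).2 fun v hv => ?_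
    have hv0 : 0 < v := by
      rw [(hpos ω).isHermitian.spectrum_real_eq_range_eigenvalues] at hv
      obtain ⟨k, rfl⟩ := hv
      exact (hpos ω).eigenvalues_pos k
    filter_upwards [h0.eventually_lt_const hε, h0.eventually_lt_const hv0,
      (tendsto_natCast_atTop_atTop (R := ℝ)).eventually_ge_atTop v] with n h1 h2 h3
    rw [dist_comm, Real.dist_eq]
    exact (hq n v ⟨h2.le, by linarith⟩).trans h1
  refine measurable_of_tendsto_metrizable (f := fun n ω => Polynomial.aeval (A ω) (q n) i j)
    (fun n => ?_) ?_
  · simp only [Polynomial.aeval_eq_sum_range, Matrix.sum_apply, Matrix.smul_apply, smul_eq_mul]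
    exact Finset.measurable_sum _ fun k _ => (measurable_matrix_pow hA k i j).const_mul _
  · rw [tendsto_pi_nhds]
    intro ω
    exact ((continuous_apply j).comp (continuous_apply i)).continuousAt.tendsto.comp (hlim ω)

lemma measurable_toLp {d : ℕ} {f : Ω → Fin d → ℝ} (hf : ∀ i, Measurable[m] fun ω => f ω i) :
    Measurable[m] fun ω => (WithLp.toLp 2 (f ω) : Vec d) :=
  (WithLp.measurable_toLp 2 (Fin d → ℝ)).comp (measurable_pi_lambda _ hf)

lemma measurable_ofLp_apply {d : ℕ} {f : Ω → Vec d} (hf : Measurable[m] f) (i : Fin d) :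
    Measurable[m] fun ω => (f ω).ofLp i :=
  (measurable_pi_apply i).comp ((WithLp.measurable_ofLp 2 (Fin d → ℝ)).comp hf)

lemma measurable_designMatrix {d : ℕ} (lam : ℝ) {x : ℕ → Ω → Vec d} {t : ℕ}
    (hx : ∀ s ∈ Finset.Ico 1 t, Measurable[m] (x s)) (i j : Fin d) :
    Measurable[m] fun ω => designMatrix lam (fun s => x s ω) t i j := by
  simp only [designMatrix, Matrix.add_apply, Matrix.sum_apply, vecMulVec_apply]
  exact measurable_const.add (Finset.measurable_sum _ fun s hs =>
    (measurable_ofLp_apply (hx s hs) i).mul (measurable_ofLp_apply (hx s hs) j))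

lemma measurable_rlsEstimate {d : ℕ} (lam : ℝ) {x : ℕ → Ω → Vec d} {r : ℕ → Ω → ℝ} {t : ℕ}
    (hx : ∀ s ∈ Finset.Ico 1 t, Measurable[m] (x s))
    (hr : ∀ s ∈ Finset.Ico 1 t, Measurable[m] (r (s + 1))) :
    Measurable[m] fun ω => rlsEstimate lam (fun s => x s ω) (fun s => r s ω) t := by
  refine measurable_toLp fun i => ?_
  simp only [mulVec, dotProduct, Finset.sum_apply, Pi.smul_apply, smul_eq_mul]
  exact Finset.measurable_sum _ fun j _ =>
    (measurable_matrix_inv (measurable_designMatrix lam hx) i j).mul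
      (Finset.measurable_sum _ fun s hs => (hr s hs).mul (measurable_ofLp_apply (hx s hs) j))

lemma measurable_whiten_designMatrix {d : ℕ} {lam : ℝ} (hlam : 0 < lam) {x : ℕ → Ω → Vec d}
    {t : ℕ} (hx : ∀ s ∈ Finset.Ico 1 t, Measurable[m] (x s)) {v : Ω → Vec d}
    (hv : Measurable[m] v) :
    Measurable[m] fun ω => whiten (designMatrix lam (fun s => x s ω) t) (v ω) := by
  simp only [whiten_apply]
  refine measurable_toLp fun i => ?_
  simp only [mulVec, dotProduct]
  exact Finset.measurable_sum _ fun j _ =>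
    (measurable_invSqrt (measurable_designMatrix lam hx)
      (fun ω => designMatrix_posDef hlam _ t) i j).mul (measurable_ofLp_apply hv j)

lemma measurable_inner_comp {d : ℕ} {f g : Ω → Vec d} (hf : Measurable[m] f)
    (hg : Measurable[m] g) : Measurable[m] fun ω => inner ℝ (f ω) (g ω) := hf.inner hg

lemma measurable_norm_comp {d : ℕ} {f : Ω → Vec d} (hf : Measurable[m] f) :
    Measurable[m] fun ω => ‖f ω‖ := hf.norm

end Measurability
end LinTS
end

/-! ### Conditionally sub-Gaussian noise and Gaussian mixing of the exponent. -/

noncomputable section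
namespace LinTS
open Matrix Filter Topology
open scoped ENNReal

lemma exists_tendsto_finite_range {Ω : Type*} {m : MeasurableSpace Ω} {a : Ω → ℝ}
    (ha : Measurable a) : ∃ s : ℕ → Ω → ℝ, (∀ n, Measurable (s n)) ∧
      (∀ n, (Set.range (s n)).Finite) ∧ ∀ ω, Tendsto (fun n => s n ω) atTop (𝓝 (a ω)) :=
  ⟨fun n => ha.stronglyMeasurable.approx n, fun n => (ha.stronglyMeasurable.approx n).measurable,
    fun n => (ha.stronglyMeasurable.approx n).finite_range, ha.stronglyMeasurable.tendsto_approx⟩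

section SubGaussian

variable {Ω : Type*} {m : MeasurableSpace Ω} [mΩ : MeasurableSpace Ω] {μ : Measure Ω}
  [IsProbabilityMeasure μ] {R : ℝ} {ξ : Ω → ℝ}

/-- Take the exponential factor as a density. The conditional bound says that the resulting measure
is dominated by `μ` on `m`-measurable sets, hence on every nonnegative `m`-measurable integrand. -/
lemma lintegral_mul_exp_const_le (hm : m ≤ mΩ) (hξ : Measurable ξ) (c : ℝ)
    (hint : Integrable (fun ω => Real.exp (c * ξ ω)) μ)
    (hsub : μ[fun ω => Real.exp (c * ξ ω) | m] ≤ᵐ[μ] fun _ => Real.exp (c ^ 2 * R ^ 2 / 2))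
    {g : Ω → ℝ≥0∞} (hg : Measurable[m] g) :
    ∫⁻ ω, g ω * ENNReal.ofReal (Real.exp (c * ξ ω - c ^ 2 * R ^ 2 / 2)) ∂μ ≤ ∫⁻ ω, g ω ∂μ := by
  set f : Ω → ℝ≥0∞ := fun ω => ENNReal.ofReal (Real.exp (c * ξ ω - c ^ 2 * R ^ 2 / 2)) with hf
  have hfm : Measurable f := by fun_prop
  have hle : (μ.withDensity f).trim hm ≤ μ.trim hm := by
    refine Measure.le_iff.2 fun A hA => ?_
    rw [trim_measurableSet_eq hm hA, trim_measurableSet_eq hm hA, withDensity_apply _ (hm A hA)]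
    have h1 : ∫⁻ ω in A, f ω ∂μ
        = ENNReal.ofReal (∫ ω in A, Real.exp (c * ξ ω) * Real.exp (-(c ^ 2 * R ^ 2 / 2)) ∂μ) := by
      rw [ofReal_integral_eq_lintegral_ofReal (hint.mul_const _).integrableOn
        (ae_of_all _ fun ω => by positivity)]
      simp only [hf, ← Real.exp_add, sub_eq_add_neg]
    have h2 : ∫ ω in A, Real.exp (c * ξ ω) ∂μ ≤ μ.real A * Real.exp (c ^ 2 * R ^ 2 / 2) := by
      rw [← setIntegral_condExp hm hint hA]
      calc _ ≤ ∫ _ω in A, Real.exp (c ^ 2 * R ^ 2 / 2) ∂μ :=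
            setIntegral_mono_ae integrable_condExp.integrableOn (integrable_const _).integrableOn hsub
        _ = _ := by simp
    rw [h1, integral_mul_const, ← ofReal_measureReal (measure_ne_top μ A)]
    refine ENNReal.ofReal_le_ofReal ?_
    calc _ ≤ μ.real A * Real.exp (c ^ 2 * R ^ 2 / 2) * Real.exp (-(c ^ 2 * R ^ 2 / 2)) := by gcongr
      _ = _ := by rw [mul_assoc, ← Real.exp_add]; simp
  calc ∫⁻ ω, g ω * f ω ∂μ = ∫⁻ ω, g ω ∂(μ.withDensity f) := by
        rw [lintegral_withDensity_eq_lintegral_mul _ hfm (hg.mono hm le_rfl)]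
        simp [mul_comm]
    _ = ∫⁻ ω, g ω ∂((μ.withDensity f).trim hm) := (lintegral_trim hm hg).symm
    _ ≤ ∫⁻ ω, g ω ∂(μ.trim hm) := lintegral_mono' hle le_rfl
    _ = _ := lintegral_trim hm hg

/-- A conditionally sub-Gaussian variable satisfies the sub-Gaussian bound at every exponent that
is measurable with respect to the conditioning σ-algebra. -/
lemma lintegral_mul_exp_le (hm : m ≤ mΩ) (hξ : Measurable ξ)
    (hint : ∀ c : ℝ, Integrable (fun ω => Real.exp (c * ξ ω)) μ)
    (hsub : ∀ c : ℝ,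
      μ[fun ω => Real.exp (c * ξ ω) | m] ≤ᵐ[μ] fun _ => Real.exp (c ^ 2 * R ^ 2 / 2))
    {a : Ω → ℝ} (ha : Measurable[m] a) {g : Ω → ℝ≥0∞} (hg : Measurable[m] g) :
    ∫⁻ ω, g ω * ENNReal.ofReal (Real.exp (a ω * ξ ω - a ω ^ 2 * R ^ 2 / 2)) ∂μ
      ≤ ∫⁻ ω, g ω ∂μ := by
  have hgΩ : Measurable g := hg.mono hm le_rfl
  obtain ⟨s, hsm, hsf, hsa⟩ := exists_tendsto_finite_range ha
  let F : ℝ → Ω → ℝ≥0∞ := fun c ω => ENNReal.ofReal (Real.exp (c * ξ ω - c ^ 2 * R ^ 2 / 2))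
  have hFm : ∀ c, Measurable (F c) := fun c => by fun_prop
  -- A finite-range exponent is constant on finitely many `m`-measurable level sets, so the constant
  -- case applies on each. Fatou's lemma then passes to the limit.
  have hsimple : ∀ n, ∫⁻ ω, g ω * F (s n ω) ω ∂μ ≤ ∫⁻ ω, g ω ∂μ := by
    intro n
    have hmeas : ∀ c, MeasurableSet[m] (s n ⁻¹' {c}) := fun c => hsm n (measurableSet_singleton c)
    have hgc : ∀ c, Measurable[m] ((s n ⁻¹' {c}).indicator g) := fun c => hg.indicator (hmeas c)
    have hdecomp : ∀ h : ℝ → ℝ≥0∞, ∀ ω,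
        g ω * h (s n ω) = ∑ c ∈ (hsf n).toFinset, (s n ⁻¹' {c}).indicator g ω * h c := by
      intro h ω
      rw [Finset.sum_eq_single (s n ω)]
      · simp
      · intro c _ hc
        rw [Set.indicator_of_notMem (by simpa using hc.symm), zero_mul]
      · intro hc
        exact absurd ((hsf n).mem_toFinset.2 ⟨ω, rfl⟩) hc
    calc ∫⁻ ω, g ω * F (s n ω) ω ∂μ
        = ∫⁻ ω, ∑ c ∈ (hsf n).toFinset, (s n ⁻¹' {c}).indicator g ω * F c ω ∂μ :=
          lintegral_congr fun ω => hdecomp (fun c => F c ω) ω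
      _ = ∑ c ∈ (hsf n).toFinset, ∫⁻ ω, (s n ⁻¹' {c}).indicator g ω * F c ω ∂μ :=
          lintegral_finsetSum _ fun c _ => ((hgc c).mono hm le_rfl).mul (hFm c)
      _ ≤ ∑ c ∈ (hsf n).toFinset, ∫⁻ ω, (s n ⁻¹' {c}).indicator g ω ∂μ :=
          Finset.sum_le_sum fun c _ =>
            lintegral_mul_exp_const_le hm hξ c (hint c) (hsub c) (hgc c)
      _ = ∫⁻ ω, ∑ c ∈ (hsf n).toFinset, (s n ⁻¹' {c}).indicator g ω * 1 ∂μ := by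
          simp only [mul_one]
          exact (lintegral_finsetSum _ fun c _ => (hgc c).mono hm le_rfl).symm
      _ = ∫⁻ ω, g ω ∂μ := by
          refine lintegral_congr fun ω => ?_
          rw [← hdecomp (fun _ => 1), mul_one]
  have hlim : ∀ ω, Tendsto (fun n => g ω * F (s n ω) ω) atTop
      (𝓝 (g ω * F (a ω) ω)) := by
    intro ω
    refine ENNReal.Tendsto.const_mul ?_ (Or.inl (by simp [F, Real.exp_pos]))
    have hc : Continuous fun c : ℝ => F c ω :=
      ENNReal.continuous_ofReal.comp (by fun_prop)
    exact (hc.tendsto _).comp (hsa ω)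
  calc ∫⁻ ω, g ω * F (a ω) ω ∂μ
      = ∫⁻ ω, liminf (fun n => g ω * F (s n ω) ω) atTop ∂μ :=
        lintegral_congr fun ω => (hlim ω).liminf_eq.symm
    _ ≤ liminf (fun n => ∫⁻ ω, g ω * F (s n ω) ω ∂μ) atTop := by
        refine lintegral_liminf_le fun n => hgΩ.mul ?_
        have : Measurable (s n) := (hsm n).mono hm le_rfl
        fun_prop
    _ ≤ liminf (fun _ : ℕ => ∫⁻ ω, g ω ∂μ) atTop :=
        liminf_le_liminf (Eventually.of_forall hsimple)
    _ = _ := by simp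

lemma lintegral_exp_affine_gaussianReal (y z : ℝ) :
    ∫⁻ u, ENNReal.ofReal (Real.exp (y + z * u)) ∂(gaussianReal 0 1)
      = ENNReal.ofReal (Real.exp (y + z ^ 2 / 2)) := by
  have hint : Integrable (fun u : ℝ => Real.exp (y + z * u)) (gaussianReal 0 1) := by
    simp only [Real.exp_add]
    exact (integrable_exp_mul_gaussianReal z).const_mul _
  rw [← ofReal_integral_eq_lintegral_ofReal hint (ae_of_all _ fun _ => by positivity)]
  congr 1
  simp only [Real.exp_add, integral_const_mul]
  have := congrFun (mgf_fun_id_gaussianReal (μ := 0) (v := 1)) z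
  simp only [mgf] at this
  rw [this]; simp

/-- Completing the square turns the integrand times the standard density into a constant times the
density of a Gaussian with variance `1 + w`. -/
lemma lintegral_exp_sq_gaussianReal {R w b : ℝ} (hR : 0 < R) (hw : 0 ≤ w) :
    ∫⁻ u, ENNReal.ofReal (Real.exp ((b / (R ^ 2 * (1 + w)) + √(w / (1 + w)) / R * u) ^ 2 * R ^ 2 / 2))
        ∂(gaussianReal 0 1)
      = ENNReal.ofReal (√(1 + w) * Real.exp (b ^ 2 / (2 * R ^ 2 * (1 + w)))) := by
  set σ := √(w / (1 + w)) with hσ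
  have hσ2 : σ ^ 2 = w / (1 + w) := Real.sq_sqrt (by positivity)
  have h1w : 0 < 1 + w := by linarith
  let v : NNReal := ⟨1 + w, h1w.le⟩
  have hv : v ≠ 0 := fun h => h1w.ne' (congrArg NNReal.toReal h)
  rw [gaussianReal_of_var_ne_zero _ one_ne_zero,
    lintegral_withDensity_eq_lintegral_mul _ (measurable_gaussianPDF _ _) (by fun_prop)]
  have hpt : ∀ u : ℝ, gaussianPDF 0 1 u * ENNReal.ofReal
      (Real.exp ((b / (R ^ 2 * (1 + w)) + σ / R * u) ^ 2 * R ^ 2 / 2))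
      = ENNReal.ofReal (√(1 + w) * Real.exp (b ^ 2 / (2 * R ^ 2 * (1 + w))))
        * gaussianPDF (b * σ / R) v u := by
    intro u
    rw [gaussianPDF, gaussianPDF, ← ENNReal.ofReal_mul (gaussianPDFReal_nonneg _ _ _),
      ← ENNReal.ofReal_mul (by positivity)]
    congr 1
    simp only [gaussianPDFReal, NNReal.coe_one, mul_one, sub_zero]
    have hvr : (v : ℝ) = 1 + w := rfl
    rw [hvr, Real.sqrt_mul (by positivity) (1 + w)]
    have hs : 0 < √(1 + w) := Real.sqrt_pos.2 h1w
    have hexp : -u ^ 2 / 2 + (b / (R ^ 2 * (1 + w)) + σ / R * u) ^ 2 * R ^ 2 / 2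
        = b ^ 2 / (2 * R ^ 2 * (1 + w)) + -(u - b * σ / R) ^ 2 / (2 * (1 + w)) := by
      have e1 : (b / (R ^ 2 * (1 + w)) + σ / R * u) ^ 2 * R ^ 2
          = b ^ 2 / (R ^ 2 * (1 + w) ^ 2) + 2 * b * σ * u / (R * (1 + w)) + σ ^ 2 * u ^ 2 := by
        field_simp
        ring
      have e2 : (u - b * σ / R) ^ 2 = u ^ 2 - 2 * b * σ * u / R + b ^ 2 * σ ^ 2 / R ^ 2 := by
        field_simp
        ring
      rw [e1, e2, hσ2]
      field_simp
      ring
    calc _ = (√(2 * Real.pi))⁻¹ * Real.exp (-u ^ 2 / 2 +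
          (b / (R ^ 2 * (1 + w)) + σ / R * u) ^ 2 * R ^ 2 / 2) := by
          rw [Real.exp_add]; ring
      _ = _ := by
          rw [hexp, Real.exp_add]
          field_simp
  simp only [Pi.mul_apply]
  rw [lintegral_congr hpt, lintegral_const_mul _ (measurable_gaussianPDF _ _),
    lintegral_gaussianPDF_eq_one _ hv, mul_one]

/-- One step of the self-normalized supermartingale, by mixing the exponent over a
one-dimensional Gaussian. -/
lemma lintegral_mul_exp_quadratic_le (hR : 0 < R) (hm : m ≤ mΩ) (hξ : Measurable ξ)
    (hint : ∀ c : ℝ, Integrable (fun ω => Real.exp (c * ξ ω)) μ)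
    (hsub : ∀ c : ℝ,
      μ[fun ω => Real.exp (c * ξ ω) | m] ≤ᵐ[μ] fun _ => Real.exp (c ^ 2 * R ^ 2 / 2))
    {b w : Ω → ℝ} (hb : Measurable[m] b) (hw : Measurable[m] w) (hw0 : ∀ ω, 0 ≤ w ω)
    {g : Ω → ℝ≥0∞} (hg : Measurable[m] g) :
    ∫⁻ ω, g ω * ENNReal.ofReal ((√(1 + w ω))⁻¹ * Real.exp
        ((2 * ξ ω * b ω + ξ ω ^ 2 * w ω - b ω ^ 2) / (2 * R ^ 2 * (1 + w ω)))) ∂μ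
      ≤ ∫⁻ ω, g ω ∂μ := by
  have hbΩ : Measurable b := hb.mono hm le_rfl
  have hwΩ : Measurable w := hw.mono hm le_rfl
  have hgΩ : Measurable g := hg.mono hm le_rfl
  -- For Gaussian `u`, the exponent `a` has mean `b/(R²(1+w))` and variance `w/(R²(1+w))`. These are
  -- chosen so that averaging `exp(aξ)` produces exactly the required linear and quadratic terms in
  -- `ξ`; `k` is the factor that normalizes the average of `exp(a²R²/2)` to one.
  let k : Ω → ℝ := fun ω => (√(1 + w ω))⁻¹ * Real.exp (-(b ω ^ 2) / (2 * R ^ 2 * (1 + w ω)))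
  let a : ℝ → Ω → ℝ := fun u ω => b ω / (R ^ 2 * (1 + w ω)) + √(w ω / (1 + w ω)) / R * u
  have hk0 : ∀ ω, 0 ≤ k ω := fun ω => by positivity
  have hkm : Measurable[m] k := by
    have := hb; have := hw; fun_prop
  have ham : ∀ u, Measurable[m] (a u) := fun u => by
    have := hb; have := hw; fun_prop
  have hkΩ : Measurable k := hkm.mono hm le_rfl
  have haΩ : Measurable (Function.uncurry a) := by
    simp only [a, Function.uncurry_def]; fun_prop
  have h1w : ∀ ω, 0 < 1 + w ω := fun ω => by linarith [hw0 ω]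
  have hmix : ∀ ω, ENNReal.ofReal ((√(1 + w ω))⁻¹ * Real.exp
        ((2 * ξ ω * b ω + ξ ω ^ 2 * w ω - b ω ^ 2) / (2 * R ^ 2 * (1 + w ω))))
      = ENNReal.ofReal (k ω) *
        ∫⁻ u, ENNReal.ofReal (Real.exp (a u ω * ξ ω)) ∂(gaussianReal 0 1) := by
    intro ω
    have e : ∀ u, a u ω * ξ ω = b ω / (R ^ 2 * (1 + w ω)) * ξ ω
        + (√(w ω / (1 + w ω)) / R * ξ ω) * u := fun u => by simp only [a]; ring
    simp only [e]
    rw [lintegral_exp_affine_gaussianReal, ← ENNReal.ofReal_mul (hk0 ω)]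
    simp only [k]
    rw [mul_assoc (√(1 + w ω))⁻¹, ← Real.exp_add]
    congr 3
    rw [mul_pow, div_pow, Real.sq_sqrt (div_nonneg (hw0 ω) (h1w ω).le)]
    have := h1w ω
    field_simp
    ring
  have hback : ∀ ω, ENNReal.ofReal (k ω) *
      ∫⁻ u, ENNReal.ofReal (Real.exp (a u ω ^ 2 * R ^ 2 / 2)) ∂(gaussianReal 0 1) = 1 := by
    intro ω
    simp only [a]
    rw [lintegral_exp_sq_gaussianReal hR (hw0 ω), ← ENNReal.ofReal_mul (hk0 ω)]
    have hs : 0 < √(1 + w ω) := Real.sqrt_pos.2 (h1w ω)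
    rw [← ENNReal.ofReal_one]
    congr 1
    simp only [k]
    rw [neg_div, Real.exp_neg]
    field_simp
  have hswap : ∀ h : ℝ → Ω → ℝ, Measurable (Function.uncurry h) →
      ∫⁻ ω, g ω * (ENNReal.ofReal (k ω) * ∫⁻ u, ENNReal.ofReal (Real.exp (h u ω))
        ∂(gaussianReal 0 1)) ∂μ
      = ∫⁻ u, ∫⁻ ω, g ω * ENNReal.ofReal (k ω) * ENNReal.ofReal (Real.exp (h u ω)) ∂μ
        ∂(gaussianReal 0 1) := by
    intro h hh
    have h2 : Measurable fun p : Ω × ℝ => h p.2 p.1 := hh.comp measurable_swap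
    rw [← lintegral_lintegral_swap]
    · refine lintegral_congr fun ω => ?_
      rw [lintegral_const_mul, mul_assoc]
      exact (h2.comp measurable_prodMk_left).exp.ennreal_ofReal
    · refine Measurable.aemeasurable ?_
      simp only [Function.uncurry_def]
      exact ((hgΩ.comp measurable_fst).mul (hkΩ.comp measurable_fst).ennreal_ofReal).mul
        h2.exp.ennreal_ofReal
  calc _ = ∫⁻ ω, g ω * (ENNReal.ofReal (k ω) *
        ∫⁻ u, ENNReal.ofReal (Real.exp (a u ω * ξ ω)) ∂(gaussianReal 0 1)) ∂μ :=
        lintegral_congr fun ω => by rw [hmix]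
    _ = ∫⁻ u, ∫⁻ ω, g ω * ENNReal.ofReal (k ω) * ENNReal.ofReal (Real.exp (a u ω * ξ ω)) ∂μ
        ∂(gaussianReal 0 1) :=
        hswap (fun u ω => a u ω * ξ ω) (haΩ.mul (hξ.comp measurable_snd))
    _ ≤ ∫⁻ u, ∫⁻ ω, g ω * ENNReal.ofReal (k ω) *
        ENNReal.ofReal (Real.exp (a u ω ^ 2 * R ^ 2 / 2)) ∂μ ∂(gaussianReal 0 1) := by
        refine lintegral_mono fun u => ?_
        have hgm : Measurable[m] fun ω => g ω * ENNReal.ofReal (k ω) *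
            ENNReal.ofReal (Real.exp (a u ω ^ 2 * R ^ 2 / 2)) := by
          have := ham u
          exact (hg.mul hkm.ennreal_ofReal).mul (by fun_prop)
        refine le_trans (le_of_eq (lintegral_congr fun ω => ?_))
          (lintegral_mul_exp_le hm hξ hint hsub (ham u) hgm)
        rw [mul_assoc (g ω * _), ← ENNReal.ofReal_mul (Real.exp_pos _).le, ← Real.exp_add]
        congr 3
        ring
    _ = ∫⁻ ω, g ω * (ENNReal.ofReal (k ω) * ∫⁻ u, ENNReal.ofReal
        (Real.exp (a u ω ^ 2 * R ^ 2 / 2)) ∂(gaussianReal 0 1)) ∂μ :=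
        (hswap (fun u ω => a u ω ^ 2 * R ^ 2 / 2)
          (((haΩ.pow_const 2).mul_const _).div_const _)).symm
    _ = _ := lintegral_congr fun ω => by rw [hback, mul_one]

/-- A variable that is conditionally `0`-sub-Gaussian vanishes almost surely. -/
lemma ae_eq_zero_of_subgaussian_zero (hm : m ≤ mΩ)
    (hint : ∀ c : ℝ, Integrable (fun ω => Real.exp (c * ξ ω)) μ)
    (hsub : ∀ c : ℝ, μ[fun ω => Real.exp (c * ξ ω) | m] ≤ᵐ[μ] fun _ => Real.exp (c ^ 2 * 0 ^ 2 / 2)) :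
    ξ =ᵐ[μ] 0 := by
  have h1 : ∀ c : ℝ, ∫ ω, Real.exp (c * ξ ω) ∂μ ≤ 1 := fun c => by
    rw [← integral_condExp hm]
    calc _ ≤ ∫ _ω, Real.exp (c ^ 2 * 0 ^ 2 / 2) ∂μ :=
          integral_mono_ae integrable_condExp (integrable_const _) (hsub c)
      _ = _ := by simp
  -- The exponents `±1` suffice: `e^ξ + e^{-ξ} - 2` is nonnegative, has mean at most zero, and
  -- vanishes only at `ξ = 0`.
  have hpos : ∀ y : ℝ, 0 ≤ Real.exp (1 * y) + Real.exp (-1 * y) - 2 := fun y => by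
    have := Real.one_le_cosh y
    rw [Real.cosh_eq] at this
    simp only [one_mul, neg_mul]; linarith
  have hi : Integrable (fun ω => Real.exp (1 * ξ ω) + Real.exp (-1 * ξ ω) - 2) μ :=
    ((hint 1).add (hint (-1))).sub (integrable_const _)
  have h2 : ∫ ω, (Real.exp (1 * ξ ω) + Real.exp (-1 * ξ ω) - 2) ∂μ = 0 := by
    refine le_antisymm ?_ (integral_nonneg fun ω => hpos _)
    rw [integral_sub (f := fun ω => Real.exp (1 * ξ ω) + Real.exp (-1 * ξ ω)) ((hint 1).add (hint (-1))) (integrable_const _), integral_add (hint 1) (hint (-1))]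
    have := h1 1; have := h1 (-1)
    simp only [integral_const, probReal_univ, smul_eq_mul]
    linarith
  rw [integral_eq_zero_iff_of_nonneg (fun ω => hpos _) hi] at h2
  filter_upwards [h2] with ω hω
  simp only [Pi.zero_apply, one_mul, neg_mul] at hω ⊢
  by_contra hne
  have := Real.one_lt_cosh.2 hne
  rw [Real.cosh_eq] at this
  linarith

end SubGaussian
end LinTS
end

/-! ### Least-squares error and the self-normalized confidence ellipsoid. -/

noncomputable section
namespace LinTS
open Matrix Filter Topology
open scoped ENNReal

/-- The noise part `∑_{s<t} ξ_{s+1} x_s` of the least-squares response. -/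
def noiseSum {d : ℕ} (x : ℕ → Vec d) (ξ : ℕ → ℝ) (t : ℕ) : Vec d :=
  ∑ s ∈ Finset.Ico 1 t, ξ (s + 1) • x s

section History

variable {Ω : Type*} {F1 : MeasurableSpace Ω} {d : ℕ} {x : ℕ → Ω → Vec d} {r : ℕ → Ω → ℝ}

lemma measurable_history_arm {t s : ℕ} (hs : s ∈ Finset.Ico 1 t) :
    Measurable[history F1 x r t] (x s) := by
  refine measurable_iff_comap_le.2 (le_sup_of_le_right ?_)
  exact le_iSup₂_of_le s hs le_sup_left

lemma measurable_history_reward {t s : ℕ} (hs : s ∈ Finset.Ico 1 t) :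
    Measurable[history F1 x r t] (r (s + 1)) := by
  refine measurable_iff_comap_le.2 (le_sup_of_le_right ?_)
  exact le_iSup₂_of_le s hs le_sup_right

lemma history_mono {s t : ℕ} (h : s ≤ t) : history F1 x r s ≤ history F1 x r t :=
  sup_le_sup_left (biSup_mono fun i hi => by simp at hi ⊢; omega) _

lemma history_le_historyArm (t : ℕ) : history F1 x r t ≤ historyArm F1 x r t := le_sup_left

lemma measurable_historyArm_arm (t : ℕ) : Measurable[historyArm F1 x r t] (x t) :=
  measurable_iff_comap_le.2 le_sup_right

end History

lemma designMatrix_mulVec {d : ℕ} (lam : ℝ) (x : ℕ → Vec d) (t : ℕ) (θ : Fin d → ℝ) :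
    designMatrix lam x t *ᵥ θ
      = lam • θ + ∑ s ∈ Finset.Ico 1 t, ((x s).ofLp ⬝ᵥ θ) • (x s).ofLp := by
  simp only [designMatrix, add_mulVec, smul_mulVec, one_mulVec, sum_mulVec]
  congr 1
  refine Finset.sum_congr rfl fun s _ => ?_
  rw [vecMulVec_mulVec, op_smul_eq_smul]

/-- The estimation error of regularized least squares, expressed through the noise. -/
lemma rlsEstimate_sub {d : ℕ} {lam : ℝ} (hlam : 0 < lam) {x : ℕ → Vec d} {r ξ : ℕ → ℝ} {t : ℕ}
    {θ : Vec d} (hr : ∀ s ∈ Finset.Ico 1 t, r (s + 1) = inner ℝ (x s) θ + ξ (s + 1)) :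
    rlsEstimate lam x r t - θ = whiten (designMatrix lam x t)
      (whiten (designMatrix lam x t) (noiseSum x ξ t - lam • θ)) := by
  set V := designMatrix lam x t with hV
  have hVpd : V.PosDef := designMatrix_posDef hlam x t
  have h1 : ∑ s ∈ Finset.Ico 1 t, r (s + 1) • (x s).ofLp
      = (noiseSum x ξ t - lam • θ).ofLp + V *ᵥ θ.ofLp := by
    rw [hV, designMatrix_mulVec]
    simp only [noiseSum, WithLp.ofLp_sub, WithLp.ofLp_sum, WithLp.ofLp_smul]
    rw [Finset.sum_congr rfl fun s hs => by rw [hr s hs, inner_eq_dotProduct, add_smul],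
      Finset.sum_add_distrib]
    abel
  have h2 : V⁻¹ *ᵥ V *ᵥ θ.ofLp = θ.ofLp := by
    rw [mulVec_mulVec, nonsing_inv_mul _ hVpd.det_pos.ne'.isUnit, one_mulVec]
  rw [whiten_whiten hVpd, rlsEstimate, h1, mulVec_add, h2, ← hV]
  ext i; simp

/-- Move one factor `V^{-1/2}` onto `v` and apply Cauchy–Schwarz. The other factor meets the noise,
bounded by `B`, and the regularization bias `λθ`, bounded by `√λ S` because `V ≥ λI`. -/
lemma abs_inner_rlsEstimate_sub_le {d : ℕ} {lam : ℝ} (hlam : 0 < lam) {x : ℕ → Vec d}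
    {r ξ : ℕ → ℝ} {t : ℕ} {θ : Vec d} {S : ℝ} (hθ : ‖θ‖ ≤ S)
    (hr : ∀ s ∈ Finset.Ico 1 t, r (s + 1) = inner ℝ (x s) θ + ξ (s + 1)) {B : ℝ}
    (hB : ‖whiten (designMatrix lam x t) (noiseSum x ξ t)‖ ≤ B) (v : Vec d) :
    |inner ℝ v (rlsEstimate lam x r t - θ)|
      ≤ ‖whiten (designMatrix lam x t) v‖ * (B + √lam * S) := by
  rw [rlsEstimate_sub hlam hr, inner_whiten]
  refine (abs_real_inner_le_norm _ _).trans (mul_le_mul_of_nonneg_left ?_ (norm_nonneg _))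
  rw [map_sub, map_smul]
  refine (norm_sub_le _ _).trans (add_le_add hB ?_)
  rw [norm_smul, Real.norm_of_nonneg hlam.le]
  have h := norm_whiten_designMatrix_le hlam x t θ
  have h0 : 0 < √lam := Real.sqrt_pos.2 hlam
  calc lam * ‖whiten (designMatrix lam x t) θ‖ ≤ lam * (S / √lam) := by
        gcongr; exact h.trans (by gcongr)
    _ = √lam * S := by
        nth_rewrite 1 [← Real.mul_self_sqrt hlam.le]
        field_simp

section Confidence

variable {Ω : Type*} {F1 : MeasurableSpace Ω} [mΩ : MeasurableSpace Ω] {μ : Measure Ω} {d : ℕ}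
  {θstar : Vec d} {R lam : ℝ} {T : ℕ} {x : ℕ → Ω → Vec d} {r ξ : ℕ → Ω → ℝ}

namespace IsLinearBandit

lemma measurable_reward (h : IsLinearBandit F1 μ θstar R T x r ξ) {t : ℕ} (h1 : 1 ≤ t)
    (hT : t ≤ T) : Measurable (r (t + 1)) := by
  have : r (t + 1) = fun ω => inner ℝ (x t ω) θstar + ξ (t + 1) ω := funext (h.reward_eq t h1 hT)
  rw [this]
  exact ((h.measurable_arm t h1 hT).inner_const).add (h.measurable_noise t h1 hT)

lemma history_le (h : IsLinearBandit F1 μ θstar R T x r ξ) (hF : F1 ≤ mΩ) {t : ℕ}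
    (hT : t ≤ T + 1) : history F1 x r t ≤ mΩ := by
  refine sup_le hF (iSup₂_le fun s hs => ?_)
  simp only [Finset.mem_Ico] at hs
  exact sup_le (h.measurable_arm s hs.1 (by omega)).comap_le
    (h.measurable_reward hs.1 (by omega)).comap_le

lemma historyArm_le (h : IsLinearBandit F1 μ θstar R T x r ξ) (hF : F1 ≤ mΩ) {t : ℕ}
    (h1 : 1 ≤ t) (hT : t ≤ T) : historyArm F1 x r t ≤ mΩ :=
  sup_le (h.history_le hF (by omega)) (h.measurable_arm t h1 hT).comap_le

/-- The parameter is deterministic, so past noise can be recovered from past arms and rewards. -/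
lemma measurable_history_noise (h : IsLinearBandit F1 μ θstar R T x r ξ) {s t : ℕ}
    (hs : s ∈ Finset.Ico 1 t) (hT : t ≤ T + 1) : Measurable[history F1 x r t] (ξ (s + 1)) := by
  have hs' := Finset.mem_Ico.1 hs
  have : ξ (s + 1) = fun ω => r (s + 1) ω - inner ℝ (x s ω) θstar := by
    ext ω; rw [h.reward_eq s hs'.1 (by omega)]; ring
  rw [this]
  exact (measurable_history_reward hs).sub ((measurable_history_arm hs).inner_const)

lemma measurable_history_noiseSum (h : IsLinearBandit F1 μ θstar R T x r ξ) {t : ℕ}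
    (hT : t ≤ T + 1) :
    Measurable[history F1 x r t] fun ω => noiseSum (fun s => x s ω) (fun s => ξ s ω) t := by
  simp only [noiseSum]
  exact Finset.measurable_sum _ fun s hs =>
    (h.measurable_history_noise hs hT).smul (measurable_history_arm hs)

end IsLinearBandit

/-- The self-normalized process whose expectation is at most one. -/
def selfNormalized (R lam : ℝ) {d : ℕ} (x : ℕ → Vec d) (ξ : ℕ → ℝ) (t : ℕ) : ℝ :=
  (√((designMatrix lam x t).det / lam ^ d))⁻¹ *
    Real.exp (‖whiten (designMatrix lam x t) (noiseSum x ξ t)‖ ^ 2 / (2 * R ^ 2))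

/-- The rank-one updates of determinant and inverse yield exactly the factor of
`lintegral_mul_exp_quadratic_le`, with `w = x_tᵀV_t⁻¹x_t` and `b` the `V_t⁻¹`-inner product of `x_t`
with the noise sum. -/
lemma selfNormalized_succ (hR : 0 < R) (hlam : 0 < lam) (x : ℕ → Vec d) (ξ : ℕ → ℝ) {t : ℕ}
    (ht : 1 ≤ t) :
    selfNormalized R lam x ξ (t + 1) = selfNormalized R lam x ξ t *
      ((√(1 + ‖whiten (designMatrix lam x t) (x t)‖ ^ 2))⁻¹ * Real.exp
        ((2 * ξ (t + 1) * inner ℝ (whiten (designMatrix lam x t) (x t))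
            (whiten (designMatrix lam x t) (noiseSum x ξ t))
          + ξ (t + 1) ^ 2 * ‖whiten (designMatrix lam x t) (x t)‖ ^ 2
          - inner ℝ (whiten (designMatrix lam x t) (x t))
            (whiten (designMatrix lam x t) (noiseSum x ξ t)) ^ 2)
        / (2 * R ^ 2 * (1 + ‖whiten (designMatrix lam x t) (x t)‖ ^ 2)))) := by
  have hV := designMatrix_posDef hlam x t
  have hV' := designMatrix_posDef hlam x (t + 1)
  have hS : noiseSum x ξ (t + 1) = noiseSum x ξ t + ξ (t + 1) • x t := by
    simp only [noiseSum, Finset.sum_Ico_succ_top ht]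
  have hsymm : (designMatrix lam x t)ᵀ = designMatrix lam x t := by
    simpa [IsHermitian] using (designMatrix_isHermitian lam x t)
  have hdet := det_designMatrix_succ hlam x ht
  have hquad : ‖whiten (designMatrix lam x (t + 1)) (noiseSum x ξ (t + 1))‖ ^ 2
      = ‖whiten (designMatrix lam x t) (noiseSum x ξ (t + 1))‖ ^ 2
        - inner ℝ (whiten (designMatrix lam x t) (x t))
          (whiten (designMatrix lam x t) (noiseSum x ξ (t + 1))) ^ 2
          / (1 + ‖whiten (designMatrix lam x t) (x t)‖ ^ 2) := by
    rw [norm_whiten_sq hV', designMatrix_succ lam x ht,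
      dotProduct_inv_add_vecMulVec_self hsymm hV.det_pos.ne'.isUnit, norm_whiten_sq hV,
      norm_whiten_sq hV, ← inner_whiten, whiten_whiten hV, inner_eq_dotProduct]
    rw [← norm_whiten_sq hV]; positivity
  have hexp : ‖whiten (designMatrix lam x t) (noiseSum x ξ (t + 1))‖ ^ 2
      = ‖whiten (designMatrix lam x t) (noiseSum x ξ t)‖ ^ 2
        + 2 * ξ (t + 1) * inner ℝ (whiten (designMatrix lam x t) (x t))
            (whiten (designMatrix lam x t) (noiseSum x ξ t))
        + ξ (t + 1) ^ 2 * ‖whiten (designMatrix lam x t) (x t)‖ ^ 2 := by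
    rw [hS, map_add, map_smul, norm_add_sq_real, real_inner_smul_right, norm_smul, mul_pow,
      Real.norm_eq_abs, sq_abs, real_inner_comm]
    ring
  have hinn : inner ℝ (whiten (designMatrix lam x t) (x t))
          (whiten (designMatrix lam x t) (noiseSum x ξ (t + 1)))
      = inner ℝ (whiten (designMatrix lam x t) (x t))
            (whiten (designMatrix lam x t) (noiseSum x ξ t))
        + ξ (t + 1) * ‖whiten (designMatrix lam x t) (x t)‖ ^ 2 := by
    rw [hS, map_add, map_smul, inner_add_right, real_inner_smul_right, real_inner_self_eq_norm_sq]
  unfold selfNormalized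
  rw [hquad, hexp, hinn, hdet]
  set w := ‖whiten (designMatrix lam x t) (x t)‖ ^ 2
  set b := inner ℝ (whiten (designMatrix lam x t) (x t))
            (whiten (designMatrix lam x t) (noiseSum x ξ t))
  have hw : 0 ≤ w := sq_nonneg _
  have h1w : 0 < 1 + w := by linarith
  rw [mul_div_right_comm, Real.sqrt_mul (div_nonneg hV.det_pos.le (by positivity)), mul_inv,
    mul_mul_mul_comm, ← Real.exp_add]
  congr 2
  field_simp
  ring

/-- The process equals one at time `1`. Each step is conditioned on `historyArm`, where the new arm
is already known but its noise is not. -/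
lemma lintegral_selfNormalized_le_one [IsProbabilityMeasure μ]
    (h : IsLinearBandit F1 μ θstar R T x r ξ) (hF : F1 ≤ mΩ) (hR : 0 < R) (hlam : 0 < lam) (n : ℕ)
    (hn : n ≤ T) :
    ∫⁻ ω, ENNReal.ofReal (selfNormalized R lam (fun s => x s ω) (fun s => ξ s ω) (n + 1)) ∂μ
      ≤ 1 := by
  induction n with
  | zero =>
    have hd : (lam ^ d) ≠ 0 := by positivity
    have : ∀ ω, selfNormalized R lam (fun s => x s ω) (fun s => ξ s ω) (0 + 1) = 1 := fun ω => by
      simp [selfNormalized, noiseSum, designMatrix_one, hd]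
    simp [this]
  | succ n ih =>
    refine le_trans ?_ (ih (by omega))
    have h1 : 1 ≤ n + 1 := by omega
    have hH : history F1 x r (n + 1) ≤ historyArm F1 x r (n + 1) := history_le_historyArm _
    have hxm : ∀ s ∈ Finset.Ico 1 (n + 1), Measurable[historyArm F1 x r (n + 1)] (x s) :=
      fun s hs => (measurable_history_arm hs).mono hH le_rfl
    have hWx := measurable_whiten_designMatrix hlam hxm
      (measurable_historyArm_arm (F1 := F1) (r := r) (x := x) (n + 1))
    have hWS := measurable_whiten_designMatrix hlam hxm
      ((h.measurable_history_noiseSum (t := n + 1) (by omega)).mono hH le_rfl)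
    have hdet := measurable_det (measurable_designMatrix lam hxm)
    have hg : Measurable[historyArm F1 x r (n + 1)] fun ω => ENNReal.ofReal
        (selfNormalized R lam (fun s => x s ω) (fun s => ξ s ω) (n + 1)) := by
      simp only [selfNormalized]
      exact ((hdet.div_const _).sqrt.inv.mul (((measurable_norm_comp hWS).pow_const 2).div_const _).exp).ennreal_ofReal
    refine le_trans (le_of_eq (lintegral_congr fun ω => ?_))
      (lintegral_mul_exp_quadratic_le hR (h.historyArm_le hF h1 hn) (h.measurable_noise _ h1 hn)
        (h.integrable_exp_noise _ h1 hn) (h.noise_subgaussian _ h1 hn) (measurable_inner_comp hWx hWS)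
        ((measurable_norm_comp hWx).pow_const 2) (fun ω => sq_nonneg _) hg)
    rw [← ENNReal.ofReal_mul (by unfold selfNormalized; positivity),
      selfNormalized_succ hR hlam _ _ h1]

/-- The radius of the noise part of the confidence ellipsoid. -/
def noiseRadius (R lam : ℝ) (d t : ℕ) (δ : ℝ) : ℝ :=
  R * √(2 * Real.log ((lam + t) ^ ((d : ℝ) / 2) * lam ^ (-((d : ℝ) / 2)) / δ))

lemma rpow_half_mul_rpow_neg_half (hlam : 0 < lam) (t d : ℕ) :
    (lam + t) ^ ((d : ℝ) / 2) * lam ^ (-((d : ℝ) / 2)) = √((lam + t) ^ d / lam ^ d) := by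
  have h : (0:ℝ) ≤ lam + t := by positivity
  rw [Real.sqrt_div (by positivity), Real.rpow_neg hlam.le, Real.sqrt_eq_rpow, Real.sqrt_eq_rpow,
    ← Real.rpow_natCast, ← Real.rpow_natCast, ← Real.rpow_mul h, ← Real.rpow_mul hlam.le,
    div_eq_mul_inv]
  ring_nf

/-- The self-normalized tail bound. -/
lemma measure_noiseRadius_lt_norm_le [IsProbabilityMeasure μ]
    (h : IsLinearBandit F1 μ θstar R T x r ξ) (hF : F1 ≤ mΩ) (hR : 0 ≤ R) (hlam : 0 < lam)
    {δ : ℝ} (hδ : 0 < δ)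
    (hx : ∀ t, 1 ≤ t → t ≤ T → ∀ ω, ‖x t ω‖ ≤ 1) {t : ℕ} (h1 : 1 ≤ t) (hT : t ≤ T) :
    μ {ω | noiseRadius R lam d t δ
      < ‖whiten (designMatrix lam (fun s => x s ω) t) (noiseSum (fun s => x s ω) (fun s => ξ s ω) t)‖}
      ≤ ENNReal.ofReal δ := by
  obtain ⟨n, rfl⟩ : ∃ n, t = n + 1 := ⟨t - 1, by omega⟩
  -- The exponent of the self-normalized process divides by `R²`, so noiseless rewards are treated
  -- apart: there the noise sum vanishes almost surely.
  rcases hR.eq_or_lt with rfl | hR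
  · have hξ : ∀ᵐ ω ∂μ, ∀ s ∈ Finset.Ico 1 (n + 1), ξ (s + 1) ω = 0 := by
      rw [Filter.eventually_all_finset]
      intro s hs
      rw [Finset.mem_Ico] at hs
      exact ae_eq_zero_of_subgaussian_zero (h.historyArm_le hF hs.1 (by omega))
        (h.integrable_exp_noise s hs.1 (by omega)) (h.noise_subgaussian s hs.1 (by omega))
    have h0 : μ {ω | noiseRadius 0 lam d (n + 1) δ
      < ‖whiten (designMatrix lam (fun s => x s ω) (n + 1))
        (noiseSum (fun s => x s ω) (fun s => ξ s ω) (n + 1))‖} = 0 := by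
      refine measure_mono_null ?_ (ae_iff.1 hξ)
      intro ω hω hcon
      have : noiseSum (fun s => x s ω) (fun s => ξ s ω) (n + 1) = 0 :=
        Finset.sum_eq_zero fun s hs => by simp only [hcon s hs, zero_smul]
      simp [noiseRadius, this] at hω
    rw [h0]; exact zero_le
  · set N : Ω → ℝ := fun ω => selfNormalized R lam (fun s => x s ω) (fun s => ξ s ω) (n + 1)
    have hsub : {ω | noiseRadius R lam d (n + 1) δ
        < ‖whiten (designMatrix lam (fun s => x s ω) (n + 1))
          (noiseSum (fun s => x s ω) (fun s => ξ s ω) (n + 1))‖}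
        ⊆ {ω | ENNReal.ofReal δ⁻¹ ≤ ENNReal.ofReal (N ω)} := by
      intro ω hω
      simp only [Set.mem_ofPred_eq] at hω ⊢
      refine ENNReal.ofReal_le_ofReal ?_
      set V := designMatrix lam (fun s => x s ω) (n + 1)
      set y := ‖whiten V (noiseSum (fun s => x s ω) (fun s => ξ s ω) (n + 1))‖
      have hdet : 0 < V.det := (designMatrix_posDef hlam _ _).det_pos
      have hld : 0 < lam ^ d := by positivity
      have hq : 0 < √(V.det / lam ^ d) := Real.sqrt_pos.2 (by positivity)
      -- This replaces the random determinant by a deterministic quantity. The tail bound is then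
      -- Markov's inequality at level `δ⁻¹`.
      have hdle : √(V.det / lam ^ d) ≤
          (lam + (n + 1 : ℕ)) ^ ((d : ℝ) / 2) * lam ^ (-((d : ℝ) / 2)) := by
        rw [rpow_half_mul_rpow_neg_half hlam]
        refine Real.sqrt_le_sqrt (div_le_div_of_nonneg_right ?_ hld.le)
        refine (det_designMatrix_le hlam _ _ fun s hs => ?_).trans ?_
        · rw [Finset.mem_Ico] at hs
          exact hx s hs.1 (by omega) ω
        · gcongr; omega
      set A := (lam + (n + 1 : ℕ)) ^ ((d : ℝ) / 2) * lam ^ (-((d : ℝ) / 2))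
      have hA : 0 < A := hq.trans_le hdle
      have hy : Real.log (A / δ) ≤ y ^ 2 / (2 * R ^ 2) := by
        have h2 : √(2 * Real.log (A / δ)) < y / R := by
          rw [lt_div_iff₀ hR, mul_comm]; exact hω
        have h3 : 2 * Real.log (A / δ) ≤ (y / R) ^ 2 := by
          rw [Real.sqrt_lt' (lt_of_le_of_lt (Real.sqrt_nonneg _) h2)] at h2
          exact h2.le
        rw [div_pow] at h3
        rw [show y ^ 2 / (2 * R ^ 2) = y ^ 2 / R ^ 2 / 2 by field_simp]
        linarith
      have hexp : A / δ ≤ Real.exp (y ^ 2 / (2 * R ^ 2)) :=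
        (Real.le_exp_log _).trans (Real.exp_le_exp.2 hy)
      calc δ⁻¹ = A⁻¹ * (A / δ) := by field_simp
        _ ≤ (√(V.det / lam ^ d))⁻¹ * Real.exp (y ^ 2 / (2 * R ^ 2)) := by gcongr
    have hNm : Measurable fun ω => ENNReal.ofReal (N ω) := by
      have hle := h.history_le hF (t := n + 1) (by omega)
      have hxm : ∀ s ∈ Finset.Ico 1 (n + 1), Measurable[history F1 x r (n + 1)] (x s) :=
        fun s hs => measurable_history_arm hs
      have hWS := (measurable_whiten_designMatrix hlam hxm
        (h.measurable_history_noiseSum (t := n + 1) (by omega))).mono hle le_rfl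
      have hdet := (measurable_det (measurable_designMatrix lam hxm)).mono hle le_rfl
      simp only [N, selfNormalized]
      exact ((hdet.div_const _).sqrt.inv.mul (((measurable_norm_comp hWS).pow_const 2).div_const _).exp).ennreal_ofReal
    refine (measure_mono hsub).trans ?_
    refine (meas_ge_le_lintegral_div hNm.aemeasurable (by simp [hδ]) (by simp)).trans ?_
    calc _ ≤ 1 / ENNReal.ofReal δ⁻¹ := by
          gcongr; exact lintegral_selfNormalized_le_one h hF hR hlam n (by omega)
      _ = ENNReal.ofReal δ := by
          rw [ENNReal.ofReal_inv_of_pos hδ, one_div, inv_inv]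

end Confidence
end LinTS
end

/-! ### Azuma–Hoeffding for conditional expectations. -/

noncomputable section
namespace LinTS
open Filter Topology
open scoped ENNReal

/-- By convexity the exponential lies below its chord over `[-B, B]`. The chord is affine in `D`,
and its linear part will integrate to zero. -/
lemma exp_mul_le_cosh_add {B D : ℝ} (s : ℝ) (hB : 0 < B) (hD : |D| ≤ B) :
    Real.exp (s * D) ≤ Real.cosh (s * B) + D * (Real.sinh (s * B) / B) := by
  obtain ⟨h1, h2⟩ := abs_le.1 hD
  have ha : 0 ≤ (1 + D / B) / 2 := by
    have : -1 ≤ D / B := by rw [le_div_iff₀ hB]; linarith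
    linarith
  have hb : 0 ≤ (1 - D / B) / 2 := by
    have : D / B ≤ 1 := by rw [div_le_iff₀ hB]; linarith
    linarith
  obtain ⟨-, hconv⟩ := convexOn_exp
  have h := hconv (Set.mem_univ (s * B)) (Set.mem_univ (-(s * B))) ha hb (by ring)
  simp only [smul_eq_mul] at h
  have e : (1 + D / B) / 2 * (s * B) + (1 - D / B) / 2 * -(s * B) = s * D := by
    field_simp; ring
  rw [e] at h
  refine h.trans (le_of_eq ?_)
  rw [Real.cosh_eq, Real.sinh_eq]
  field_simp
  ring

lemma condExp_mem_Icc {Ω : Type*} {m : MeasurableSpace Ω} {mΩ : MeasurableSpace Ω} {μ : Measure Ω}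
    [IsProbabilityMeasure μ] (hm : m ≤ mΩ) {y : Ω → ℝ} {B : ℝ} (hy : Measurable y)
    (h0 : ∀ ω, 0 ≤ y ω) (hB : ∀ ω, y ω ≤ B) : ∀ᵐ ω ∂μ, (μ[y | m]) ω ∈ Set.Icc 0 B := by
  have hint : Integrable y μ := Integrable.of_bound hy.aestronglyMeasurable B
    (ae_of_all _ fun ω => by rw [Real.norm_of_nonneg (h0 ω)]; exact hB ω)
  have h1 := condExp_mono (m := m) (μ := μ) (integrable_const (0:ℝ)) hint (ae_of_all _ h0)
  have h2 := condExp_mono (m := m) (μ := μ) hint (integrable_const B) (ae_of_all _ hB)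
  rw [condExp_const hm] at h1 h2
  filter_upwards [h1, h2] with ω a b using ⟨a, b⟩

section Azuma

variable {Ω : Type*} [mΩ : MeasurableSpace Ω] {μ : Measure Ω}
  {F : ℕ → MeasurableSpace Ω} {y : ℕ → Ω → ℝ} {B : ℝ} {T : ℕ}

/-- The compensated sum `∑_{t=1}^n (E[y_t | F_t] - y_t)`. -/
def compensatedSum (μ : Measure Ω) (F : ℕ → MeasurableSpace Ω) (y : ℕ → Ω → ℝ) (n : ℕ) (ω : Ω) : ℝ :=
  ∑ t ∈ Finset.Icc 1 n, ((μ[y t | F t]) ω - y t ω)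

lemma compensatedSum_measurable (hmono : Monotone F)
    (hy : ∀ t, 1 ≤ t → t ≤ T → Measurable[F (t + 1)] (y t)) {n : ℕ} (hn : n ≤ T) :
    Measurable[F (n + 1)] (compensatedSum μ F y n) := by
  unfold compensatedSum
  refine Finset.measurable_sum _ fun t ht => ?_
  rw [Finset.mem_Icc] at ht
  exact (stronglyMeasurable_condExp.measurable.mono (hmono (by omega)) le_rfl).sub
    ((hy t ht.1 (by omega)).mono (hmono (by omega)) le_rfl)

/-- Both `y_t` and its conditional expectation lie in `[0, B]`, so increments are bounded by `B`
rather than `2B`. The chord bound costs a factor `cosh(sB) ≤ exp(s²B²/2)` per step. -/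
lemma compensatedSum_exp_integral [IsProbabilityMeasure μ] (hmono : Monotone F) (hF : ∀ t ≤ T + 1, F t ≤ mΩ)
    (hy : ∀ t, 1 ≤ t → t ≤ T → Measurable[F (t + 1)] (y t)) (hB : 0 < B)
    (h0 : ∀ t, 1 ≤ t → t ≤ T → ∀ ω, 0 ≤ y t ω) (hyB : ∀ t, 1 ≤ t → t ≤ T → ∀ ω, y t ω ≤ B)
    (s : ℝ) (n : ℕ) (hn : n ≤ T) :
    Integrable (fun ω => Real.exp (s * compensatedSum μ F y n ω)) μ ∧
      ∫ ω, Real.exp (s * compensatedSum μ F y n ω) ∂μ ≤ Real.exp (n * (s ^ 2 * B ^ 2 / 2)) := by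
  have hyΩ : ∀ t, 1 ≤ t → t ≤ T → Measurable (y t) := fun t h1 hT =>
    (hy t h1 hT).mono (hF _ (by omega)) le_rfl
  have hD : ∀ t, 1 ≤ t → t ≤ T → ∀ᵐ ω ∂μ, |(μ[y t | F t]) ω - y t ω| ≤ B := by
    intro t h1 hT
    filter_upwards [condExp_mem_Icc (hF t (by omega)) (hyΩ t h1 hT) (h0 t h1 hT) (hyB t h1 hT)]
      with ω hω
    have := h0 t h1 hT ω; have := hyB t h1 hT ω
    rw [abs_le]; constructor <;> linarith [hω.1, hω.2]
  have hbd : ∀ n ≤ T, ∀ᵐ ω ∂μ, |compensatedSum μ F y n ω| ≤ n * B := by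
    intro n hn
    have : ∀ᵐ ω ∂μ, ∀ t ∈ Finset.Icc 1 n, |(μ[y t | F t]) ω - y t ω| ≤ B := by
      rw [Filter.eventually_all_finset]
      intro t ht
      rw [Finset.mem_Icc] at ht
      exact hD t ht.1 (by omega)
    filter_upwards [this] with ω hω
    refine (Finset.abs_sum_le_sum_abs _ _).trans ((Finset.sum_le_sum hω).trans ?_)
    simp
  have hcm : ∀ n ≤ T, Measurable (compensatedSum μ F y n) := fun n hn =>
    (compensatedSum_measurable hmono hy hn).mono (hF _ (by omega)) le_rfl
  have hint : ∀ n ≤ T, Integrable (fun ω => Real.exp (s * compensatedSum μ F y n ω)) μ := by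
    intro n hn
    refine Integrable.of_bound ((hcm n hn).const_mul s).exp.aestronglyMeasurable
      (Real.exp (|s| * (n * B))) ?_
    filter_upwards [hbd n hn] with ω hω
    rw [Real.norm_of_nonneg (Real.exp_pos _).le]
    refine Real.exp_le_exp.2 ((le_abs_self _).trans ?_)
    rw [abs_mul]
    gcongr
  refine ⟨hint n hn, ?_⟩
  induction n with
  | zero => simp [compensatedSum]
  | succ n ih =>
    have ih := ih (by omega)
    have h1 : 1 ≤ n + 1 := by omega
    set g : Ω → ℝ := fun ω => Real.exp (s * compensatedSum μ F y n ω) with hg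
    have hgi : Integrable g μ := hint n (by omega)
    have hgm : StronglyMeasurable[F (n + 1)] g :=
      (((compensatedSum_measurable hmono hy (by omega)).const_mul s).exp).stronglyMeasurable
    have hyi : Integrable (y (n + 1)) μ :=
      Integrable.of_bound (hyΩ _ h1 hn).aestronglyMeasurable B
        (ae_of_all _ fun ω => by
          rw [Real.norm_of_nonneg (h0 _ h1 hn ω)]; exact hyB _ h1 hn ω)
    have hgyi : Integrable (g * y (n + 1)) μ :=
      hgi.mul_bdd (c := B) (hyΩ _ h1 hn).aestronglyMeasurable (ae_of_all _ fun ω => by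
          rw [Real.norm_of_nonneg (h0 _ h1 hn ω)]; exact hyB _ h1 hn ω)
    have hpull := condExp_mul_of_stronglyMeasurable_left hgm hgyi hyi
    have hgci : Integrable (g * μ[y (n + 1) | F (n + 1)]) μ :=
      (integrable_congr hpull).1 integrable_condExp
    -- The factor `g` is known at time `n + 1`, so it can be pulled out of the conditional
    -- expectation.
    have hzero : ∫ ω, g ω * ((μ[y (n + 1) | F (n + 1)]) ω - y (n + 1) ω) ∂μ = 0 := by
      simp only [mul_sub]
      rw [integral_sub (f := fun ω => g ω * (μ[y (n + 1) | F (n + 1)]) ω)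
        (g := fun ω => g ω * y (n + 1) ω) hgci hgyi, sub_eq_zero,
        ← integral_condExp (hF (n + 1) (by omega)) (f := fun ω => g ω * y (n + 1) ω)]
      exact (integral_congr_ae hpull).symm
    have hDi : Integrable (fun ω => g ω * ((μ[y (n + 1) | F (n + 1)]) ω - y (n + 1) ω)) μ := by
      simp only [mul_sub]; exact hgci.sub hgyi
    have hstep : ∫ ω, Real.exp (s * compensatedSum μ F y (n + 1) ω) ∂μ
        ≤ Real.cosh (s * B) * ∫ ω, g ω ∂μ := by
      calc _ ≤ ∫ ω, (Real.cosh (s * B) * g ω + Real.sinh (s * B) / B *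
            (g ω * ((μ[y (n + 1) | F (n + 1)]) ω - y (n + 1) ω))) ∂μ := by
            refine integral_mono_ae (hint _ hn) ((hgi.const_mul _).add (hDi.const_mul _)) ?_
            filter_upwards [hD (n + 1) h1 hn] with ω hω
            have e : compensatedSum μ F y (n + 1) ω = compensatedSum μ F y n ω
                + ((μ[y (n + 1) | F (n + 1)]) ω - y (n + 1) ω) := by
              simp only [compensatedSum]
              rw [Finset.sum_Icc_succ_top h1]
            have := mul_le_mul_of_nonneg_left (exp_mul_le_cosh_add s hB hω)
              (Real.exp_pos (s * compensatedSum μ F y n ω)).le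
            simp only [e, mul_add s, Real.exp_add, hg]
            linarith
        _ = _ := by
            rw [integral_add (hgi.const_mul _) (hDi.const_mul _), integral_const_mul,
              integral_const_mul, hzero]
            simp
    refine hstep.trans ?_
    have hc := Real.cosh_le_exp_half_sq (s * B)
    calc _ ≤ Real.exp ((s * B) ^ 2 / 2) * Real.exp (n * (s ^ 2 * B ^ 2 / 2)) := by
          gcongr
      _ = _ := by rw [← Real.exp_add]; congr 1; push_cast; ring

/-- The Azuma–Hoeffding inequality for the compensated sum of a bounded adapted process. -/
lemma measure_compensatedSum_ge_le [IsProbabilityMeasure μ] (hT : 1 ≤ T) (hmono : Monotone F) (hF : ∀ t ≤ T + 1, F t ≤ mΩ)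
    (hy : ∀ t, 1 ≤ t → t ≤ T → Measurable[F (t + 1)] (y t)) (hB : 0 < B)
    (h0 : ∀ t, 1 ≤ t → t ≤ T → ∀ ω, 0 ≤ y t ω) (hyB : ∀ t, 1 ≤ t → t ≤ T → ∀ ω, y t ω ≤ B)
    {q : ℝ} (hq0 : 0 < q) (hq1 : q ≤ 1) :
    μ.real {ω | B * √(2 * T * Real.log (1 / q)) ≤ compensatedSum μ F y T ω} ≤ q := by
  set ε := B * √(2 * T * Real.log (1 / q)) with hε
  have hT0 : (0:ℝ) < T := by exact_mod_cast hT
  have hlog : 0 ≤ Real.log (1 / q) := Real.log_nonneg (by rw [le_div_iff₀ hq0]; linarith)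
  have hε2 : ε ^ 2 = B ^ 2 * (2 * T * Real.log (1 / q)) := by
    rw [hε, mul_pow, Real.sq_sqrt (by positivity)]
  -- The value `s = ε/(TB²)` minimizes the Chernoff exponent `-sε + T s²B²/2`.
  obtain ⟨hi, hle⟩ := compensatedSum_exp_integral (μ := μ) hmono hF hy hB h0 hyB
    (ε / (T * B ^ 2)) T le_rfl
  refine (measure_ge_le_exp_mul_mgf ε (t := ε / (T * B ^ 2)) (by positivity) hi).trans ?_
  calc _ ≤ Real.exp (-(ε / (T * B ^ 2)) * ε) * Real.exp (T * ((ε / (T * B ^ 2)) ^ 2 * B ^ 2 / 2)) := by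
        gcongr; exact hle
    _ = Real.exp (-Real.log (1 / q)) := by
        rw [← Real.exp_add]
        congr 1
        rw [show -(ε / (T * B ^ 2)) * ε + T * ((ε / (T * B ^ 2)) ^ 2 * B ^ 2 / 2)
          = -(ε ^ 2 / (2 * T * B ^ 2)) by field_simp; ring, hε2]
        field_simp
    _ = q := by rw [one_div, Real.log_inv, neg_neg, Real.exp_log hq0]

end Azuma
end LinTS
end

/-! ### The optimal value, freezing of a fresh sample, and optimistic directions. -/

noncomputable section
namespace LinTS
open Filter Topology
open scoped ENNReal

/-- The optimal value `sup_{y ∈ X} yᵀθ`. -/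
def optValue {d : ℕ} (X : Set (Vec d)) (θ : Vec d) : ℝ := ⨆ y : X, inner ℝ (y : Vec d) θ

section OptValue

variable {d : ℕ} {X : Set (Vec d)}

lemma bddAbove_range_inner (hX : ∀ y ∈ X, ‖y‖ ≤ 1) (θ : Vec d) :
    BddAbove (Set.range fun y : X => inner ℝ (y : Vec d) θ) := by
  refine ⟨‖θ‖, ?_⟩
  rintro _ ⟨y, rfl⟩
  exact (real_inner_le_norm _ _).trans (mul_le_of_le_one_left (norm_nonneg _) (hX y y.2))

lemma inner_le_optValue (hX : ∀ y ∈ X, ‖y‖ ≤ 1) {y : Vec d} (hy : y ∈ X) (θ : Vec d) :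
    inner ℝ y θ ≤ optValue X θ :=
  le_ciSup (bddAbove_range_inner hX θ) (⟨y, hy⟩ : X)

lemma IsOptimalArm.optValue_eq (hX : ∀ y ∈ X, ‖y‖ ≤ 1) {θ x : Vec d} (h : IsOptimalArm X θ x) :
    optValue X θ = inner ℝ x θ := by
  have : Nonempty X := ⟨⟨x, h.1⟩⟩
  exact le_antisymm (ciSup_le fun y => h.2 y y.2) (inner_le_optValue hX h.1 θ)

/-- A supremum of 1-Lipschitz functionals. The resulting continuity gives measurability and lets a
countable dense set of perturbations stand for the whole ball. -/
lemma lipschitzWith_optValue (hX : ∀ y ∈ X, ‖y‖ ≤ 1) (hne : X.Nonempty) :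
    LipschitzWith 1 (optValue X) := by
  have : Nonempty X := hne.to_subtype
  refine LipschitzWith.of_le_add fun θ θ' => ciSup_le fun y => ?_
  have h1 := inner_le_optValue hX y.2 θ'
  have h2 : inner ℝ (y : Vec d) (θ - θ') ≤ dist θ θ' := by
    rw [dist_eq_norm]
    exact (real_inner_le_norm _ _).trans (mul_le_of_le_one_left (norm_nonneg _) (hX y y.2))
  rw [inner_sub_right] at h2
  linarith

end OptValue

/-- A dense sequence of the closed ball of radius `ρ` around the origin. -/
def ballSeq (d : ℕ) {ρ : ℝ} (hρ : 0 ≤ ρ) (i : ℕ) : Vec d :=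
  have : Nonempty (Metric.closedBall (0 : Vec d) ρ) := ⟨⟨0, by simp [hρ]⟩⟩
  (TopologicalSpace.denseSeq (Metric.closedBall (0 : Vec d) ρ) i : Vec d)

lemma norm_ballSeq_le {d : ℕ} {ρ : ℝ} (hρ : 0 ≤ ρ) (i : ℕ) : ‖ballSeq d hρ i‖ ≤ ρ := by
  have : Nonempty (Metric.closedBall (0 : Vec d) ρ) := ⟨⟨0, by simp [hρ]⟩⟩
  exact mem_closedBall_zero_iff.1 (TopologicalSpace.denseSeq (Metric.closedBall (0 : Vec d) ρ) i).2

/-- The infimum over a dense sequence is countable, hence measurable in parameters, and by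
continuity still bounds the function below on the whole ball. -/
lemma ciInf_ballSeq_le {d : ℕ} {ρ : ℝ} (hρ : 0 ≤ ρ) {f : Vec d → ℝ} (hf : Continuous f)
    (hbdd : BddBelow (Set.range fun i => f (ballSeq d hρ i))) {v : Vec d} (hv : ‖v‖ ≤ ρ) :
    ⨅ i, f (ballSeq d hρ i) ≤ f v := by
  have hne : Nonempty (Metric.closedBall (0 : Vec d) ρ) := ⟨⟨0, by simp [hρ]⟩⟩
  have hcl : IsClosed {w : Metric.closedBall (0 : Vec d) ρ | ⨅ i, f (ballSeq d hρ i) ≤ f w} :=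
    isClosed_le continuous_const (hf.comp continuous_subtype_val)
  have := (TopologicalSpace.denseRange_denseSeq (Metric.closedBall (0 : Vec d) ρ)).induction_on
    (p := fun w => ⨅ i, f (ballSeq d hρ i) ≤ f w) ⟨v, by simpa using hv⟩ hcl
    (fun i => ciInf_le hbdd i)
  exact this

/-- Freezing: a fresh sample that is independent of `m` hits a set depending on an `m`-measurable
parameter with at least the probability that it has for fixed parameters. -/
lemma lintegral_mul_indicator_ge {Ω E : Type*} {m : MeasurableSpace Ω} [mΩ : MeasurableSpace Ω]
    [MeasurableSpace E] {μ : Measure Ω} [IsProbabilityMeasure μ] {D : Measure E}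
    [IsProbabilityMeasure D] (hm : m ≤ mΩ) {η v : Ω → E} (hη : Measurable η)
    (hlaw : μ.map η = D) (hind : Indep (MeasurableSpace.comap η inferInstance) m μ)
    (hv : Measurable[m] v) {h : Ω → ℝ≥0∞} (hh : Measurable[m] h) {Q : Set (E × E)}
    (hQ : MeasurableSet Q) {q : ℝ≥0∞} (hq : ∀ u, q ≤ D {e | (u, e) ∈ Q}) :
    q * ∫⁻ ω, h ω ∂μ ≤ ∫⁻ ω, h ω * Q.indicator 1 (v ω, η ω) ∂μ := by
  have hvΩ : Measurable v := hv.mono hm le_rfl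
  have hhΩ : Measurable h := hh.mono hm le_rfl
  have hpm : Measurable[m] fun ω => (h ω, v ω) := hh.prodMk hv
  have hpΩ : Measurable fun ω => (h ω, v ω) := hhΩ.prodMk hvΩ
  have hI : IndepFun (fun ω => (h ω, v ω)) η μ :=
    (indep_of_indep_of_le_right hind hpm.comap_le).symm
  have hmap := (indepFun_iff_map_prod_eq_prod_map_map hpΩ.aemeasurable hη.aemeasurable).1 hI
  rw [hlaw] at hmap
  let Φ : (ℝ≥0∞ × E) × E → ℝ≥0∞ := fun z => z.1.1 * Q.indicator 1 (z.1.2, z.2)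
  have hQi : Measurable (Q.indicator (1 : E × E → ℝ≥0∞)) := measurable_one.indicator hQ
  have hΦ : Measurable Φ :=
    (measurable_fst.comp measurable_fst).mul
      (hQi.comp ((measurable_snd.comp measurable_fst).prodMk measurable_snd))
  have e1 : ∫⁻ ω, h ω * Q.indicator 1 (v ω, η ω) ∂μ
      = ∫⁻ z, Φ z ∂(μ.map fun ω => ((h ω, v ω), η ω)) := by
    rw [lintegral_map hΦ (hpΩ.prodMk hη)]
  have hprob : IsProbabilityMeasure (μ.map fun ω => (h ω, v ω)) :=
    Measure.isProbabilityMeasure_map hpΩ.aemeasurable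
  rw [e1, hmap, lintegral_prod _ hΦ.aemeasurable, lintegral_map hΦ.lintegral_prod_right' hpΩ,
    ← lintegral_const_mul _ hhΩ]
  refine lintegral_mono fun ω => ?_
  simp only [Φ]
  have hc : Measurable fun e => Q.indicator (1 : E × E → ℝ≥0∞) (v ω, e) :=
    hQi.comp measurable_prodMk_left
  rw [lintegral_const_mul _ hc, mul_comm]
  refine mul_le_mul_right ?_ _
  refine (hq (v ω)).trans (le_of_eq ?_)
  have : (fun e => Q.indicator (1 : E × E → ℝ≥0∞) (v ω, e))
      = ({e | (v ω, e) ∈ Q} : Set E).indicator 1 := by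
    ext e; simp [Set.indicator]
  have hms : MeasurableSet {e | (v ω, e) ∈ Q} := measurable_prodMk_left hQ
  rw [this]
  exact (lintegral_indicator_one hms).symm

/-- Both functions live on the trimmed measure space, so testing on `m`-measurable sets is enough.
-/
lemma ae_le_of_forall_setIntegral_le_of_measurable {Ω : Type*} {m mΩ : MeasurableSpace Ω}
    {μ : Measure Ω} [IsProbabilityMeasure μ] (hm : m ≤ mΩ) {f g : Ω → ℝ}
    (hf : StronglyMeasurable[m] f) (hg : StronglyMeasurable[m] g) (hfi : Integrable f μ)
    (hgi : Integrable g μ) (h : ∀ A, MeasurableSet[m] A → ∫ ω in A, f ω ∂μ ≤ ∫ ω in A, g ω ∂μ) :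
    f ≤ᵐ[μ] g := by
  refine ae_le_of_ae_le_trim (hm := hm) ?_
  refine ae_le_of_forall_setIntegral_le (hfi.trim hm hf) (hgi.trim hm hg) fun A hA _ => ?_
  rw [← setIntegral_trim hm hf hA, ← setIntegral_trim hm hg hA]
  exact h A hA

namespace IsTSDistribution

variable {d : ℕ} {D : Measure (Vec d)} {p c c' : ℝ}

lemma p_le_one (h : IsTSDistribution D p c c') (hd : 1 ≤ d) : p ≤ 1 := by
  have := h.isProbabilityMeasure
  have hu : ‖(EuclideanSpace.single (⟨0, hd⟩ : Fin d) (1:ℝ) : Vec d)‖ = 1 := by simp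
  exact (h.anti_concentration _ hu).trans measureReal_le_one

/-- With probability `p - δ`, a sample is both optimistic in direction `v` and in the
concentration ball. -/
lemma le_measureReal_optimistic (h : IsTSDistribution D p c c') (hd : 1 ≤ d) {δ : ℝ} (h0 : 0 < δ)
    (h1 : δ < 1) (v : Vec d) :
    p - δ ≤ D.real {η | ‖η‖ ≤ √(c * d * Real.log (c' * d / δ)) ∧ ‖v‖ ≤ inner ℝ v η} := by
  have := h.isProbabilityMeasure
  set B := {η : Vec d | ‖η‖ ≤ √(c * d * Real.log (c' * d / δ))} with hB
  have hBm : MeasurableSet B := measurableSet_le measurable_norm measurable_const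
  have hconc := h.concentration δ h0 h1
  -- In the zero direction every sample is optimistic, and `p ≤ 1` closes the case; otherwise
  -- normalize `v` and intersect the half-space with the ball.
  rcases eq_or_ne v 0 with rfl | hv
  · have e : {η : Vec d | ‖η‖ ≤ √(c * d * Real.log (c' * d / δ)) ∧ ‖(0 : Vec d)‖ ≤ inner ℝ 0 η} = B := by
      ext η; simp [hB]
    rw [e]
    linarith [h.p_le_one hd]
  · have hvn : 0 < ‖v‖ := norm_pos_iff.2 hv
    set H := {η : Vec d | 1 ≤ inner ℝ (‖v‖⁻¹ • v) η} with hH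
    have hu : ‖(‖v‖⁻¹ • v)‖ = 1 := by
      rw [norm_smul, norm_inv, norm_norm, inv_mul_cancel₀ hvn.ne']
    have hHp := h.anti_concentration _ hu
    have e : {η : Vec d | ‖η‖ ≤ √(c * d * Real.log (c' * d / δ)) ∧ ‖v‖ ≤ inner ℝ v η} = B ∩ H := by
      ext η
      simp only [hB, hH, Set.mem_ofPred_eq, Set.mem_inter_iff, real_inner_smul_left]
      rw [inv_mul_eq_div, le_div_iff₀ hvn, one_mul]
    have h2 : D.real H ≤ D.real (B ∩ H) + D.real Bᶜ := by
      refine (measureReal_mono (s₂ := (B ∩ H) ∪ Bᶜ) fun η hη => ?_).trans (measureReal_union_le _ _)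
      by_cases hηB : η ∈ B
      · exact Or.inl ⟨hηB, hη⟩
      · exact Or.inr hηB
    have h3 : D.real Bᶜ ≤ δ := by
      rw [probReal_compl_eq_one_sub hBm]; linarith
    rw [e]
    linarith

end IsTSDistribution
end LinTS
end

/-! ### Pathwise optimism and its conditional form. -/

noncomputable section
namespace LinTS
open Filter Topology
open scoped ENNReal

lemma perturbed_eq {d : ℕ} (R S lam δ : ℝ) (x : ℕ → Vec d) (r : ℕ → ℝ) (η : Vec d) (t : ℕ) :
    perturbed R S lam δ x r η t
      = rlsEstimate lam x r t + beta R S lam d t δ • whiten (designMatrix lam x t) η := rfl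

lemma inner_perturbed {d : ℕ} (R S lam δ : ℝ) (x : ℕ → Vec d) (r : ℕ → ℝ) (η : Vec d) (t : ℕ)
    (v : Vec d) :
    inner ℝ v (perturbed R S lam δ x r η t) = inner ℝ v (rlsEstimate lam x r t)
      + beta R S lam d t δ * inner ℝ (whiten (designMatrix lam x t) v) η := by
  rw [← inner_whiten, ← real_inner_smul_right, ← inner_add_right, perturbed_eq]

lemma beta_eq (R S lam : ℝ) (d t : ℕ) (δ : ℝ) :
    beta R S lam d t δ = noiseRadius R lam d t δ + √lam * S := rfl

lemma gamma_eq (R S lam c c' : ℝ) (d t : ℕ) (δ : ℝ) :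
    gamma R S lam c c' d t δ = beta R S lam d t δ * √(c * d * Real.log (c' * d / δ)) := rfl

lemma noiseRadius_nonneg {R lam : ℝ} (hR : 0 ≤ R) (d t : ℕ) (δ : ℝ) :
    0 ≤ noiseRadius R lam d t δ := mul_nonneg hR (Real.sqrt_nonneg _)

lemma beta_nonneg {R S lam : ℝ} (hR : 0 ≤ R) (hS : 0 ≤ S) (d t : ℕ) (δ : ℝ) :
    0 ≤ beta R S lam d t δ :=
  add_nonneg (noiseRadius_nonneg hR _ _ _) (mul_nonneg (Real.sqrt_nonneg _) hS)

lemma beta_mono {R S lam : ℝ} (hR : 0 ≤ R) (hlam : 0 < lam) (d : ℕ) {s t : ℕ} (hst : s ≤ t)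
    {δ : ℝ} (hδ : 0 < δ) : beta R S lam d s δ ≤ beta R S lam d t δ := by
  rw [beta_eq, beta_eq]
  unfold noiseRadius
  gcongr

section Pathwise

variable {d : ℕ} {X : Set (Vec d)} {R S lam δ ρ : ℝ} {θstar xstar : Vec d} {x : ℕ → Vec d}
  {r ξ : ℕ → ℝ} {η : Vec d} {t : ℕ}

/-- On the confidence event, an optimistic sample in the ball controls the optimism gap of every
other sample in the ball. -/
lemma optValue_sub_optValue_perturbed_le (hX : ∀ y ∈ X, ‖y‖ ≤ 1) (hR : 0 ≤ R) (hS : 0 ≤ S)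
    (hlam : 0 < lam) (hθ : ‖θstar‖ ≤ S) (hopt : IsOptimalArm X θstar xstar)
    (hr : ∀ s ∈ Finset.Ico 1 t, r (s + 1) = inner ℝ (x s) θstar + ξ (s + 1))
    (hconf : ‖whiten (designMatrix lam x t) (noiseSum x ξ t)‖ ≤ noiseRadius R lam d t δ)
    (harm : IsOptimalArm X (perturbed R S lam δ x r η t) (x t)) (hη : ‖η‖ ≤ ρ)
    (hηopt : ‖whiten (designMatrix lam x t) xstar‖
      ≤ inner ℝ (whiten (designMatrix lam x t) xstar) η) {η' : Vec d} (hη' : ‖η'‖ ≤ ρ) :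
    optValue X θstar - optValue X (perturbed R S lam δ x r η' t)
      ≤ 2 * (beta R S lam d t δ * ρ) * ‖whiten (designMatrix lam x t) (x t)‖ := by
  have hβ := beta_nonneg (lam := lam) hR hS d t δ
  set W := whiten (designMatrix lam x t)
  have h1 := abs_le.1 (abs_inner_rlsEstimate_sub_le hlam hθ hr hconf xstar)
  rw [← beta_eq, inner_sub_right] at h1
  -- At `x⋆` the estimation error costs at most `β‖W x⋆‖`, and the optimistic perturbation gains at
  -- least as much.
  have h2 : optValue X θstar ≤ inner ℝ (x t) (perturbed R S lam δ x r η t) := by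
    rw [hopt.optValue_eq hX]
    refine le_trans ?_ (harm.2 xstar hopt.1)
    rw [inner_perturbed]
    nlinarith [h1.1]
  have h3 := inner_le_optValue hX harm.1 (perturbed R S lam δ x r η' t)
  -- Two perturbations in the ball are at distance at most `2ρ`, whence the factor `2`. The arm
  -- `x_t` is a competitor for the other perturbed parameter, so its value bounds that optimum
  -- below.
  have h4 : inner ℝ (W (x t)) (η - η') ≤ ‖W (x t)‖ * (2 * ρ) := by
    refine (real_inner_le_norm _ _).trans (mul_le_mul_of_nonneg_left ?_ (norm_nonneg _))
    exact (norm_sub_le _ _).trans (by linarith)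
  rw [inner_sub_right] at h4
  rw [inner_perturbed] at h2 h3
  nlinarith

/-- A bound that needs no optimism. It supplies the deterministic cap at which the gap may be
truncated without loss, making it integrable. -/
lemma optValue_sub_inner_perturbed_le (hX : ∀ y ∈ X, ‖y‖ ≤ 1) (hR : 0 ≤ R) (hS : 0 ≤ S)
    (hlam : 1 ≤ lam) (hθ : ‖θstar‖ ≤ S) (hopt : IsOptimalArm X θstar xstar)
    (hr : ∀ s ∈ Finset.Ico 1 t, r (s + 1) = inner ℝ (x s) θstar + ξ (s + 1))
    (hconf : ‖whiten (designMatrix lam x t) (noiseSum x ξ t)‖ ≤ noiseRadius R lam d t δ)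
    (harm : IsOptimalArm X (perturbed R S lam δ x r η t) (x t)) (hη : ‖η‖ ≤ ρ) :
    optValue X θstar - inner ℝ (x t) (perturbed R S lam δ x r η t)
      ≤ beta R S lam d t δ + beta R S lam d t δ * ρ := by
  have hlam0 : 0 < lam := by linarith
  have hβ := beta_nonneg (lam := lam) hR hS d t δ
  have hρ : 0 ≤ ρ := (norm_nonneg _).trans hη
  have hW : ‖whiten (designMatrix lam x t) xstar‖ ≤ 1 := by
    refine (norm_whiten_designMatrix_le hlam0 x t xstar).trans ?_
    rw [div_le_one (by positivity)]
    exact (hX _ hopt.1).trans (by simpa using Real.sqrt_le_sqrt hlam)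
  have h1 := abs_le.1 (abs_inner_rlsEstimate_sub_le hlam0 hθ hr hconf xstar)
  rw [← beta_eq, inner_sub_right] at h1
  have h2 := harm.2 xstar hopt.1
  have h3 := abs_le.1 (abs_real_inner_le_norm (whiten (designMatrix lam x t) xstar) η)
  have h4 : ‖whiten (designMatrix lam x t) xstar‖ * ‖η‖ ≤ 1 * ρ := by gcongr
  rw [hopt.optValue_eq hX]
  rw [inner_perturbed] at h2
  have h5 : ‖whiten (designMatrix lam x t) xstar‖ * beta R S lam d t δ ≤ beta R S lam d t δ :=
    mul_le_of_le_one_left hβ hW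
  have h6 : -(beta R S lam d t δ * ρ)
      ≤ beta R S lam d t δ * inner ℝ (whiten (designMatrix lam x t) xstar) η := by
    rw [← mul_neg]
    exact mul_le_mul_of_nonneg_left (by linarith [h3.1]) hβ
  linarith [h1.1]

/-- The prediction half of the regret: estimation error and perturbation are both paid in the
`V_t⁻¹`-norm of the played arm. -/
lemma inner_perturbed_sub_le (hR : 0 ≤ R) (hS : 0 ≤ S)
    (hlam : 0 < lam) (hθ : ‖θstar‖ ≤ S)
    (hr : ∀ s ∈ Finset.Ico 1 t, r (s + 1) = inner ℝ (x s) θstar + ξ (s + 1))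
    (hconf : ‖whiten (designMatrix lam x t) (noiseSum x ξ t)‖ ≤ noiseRadius R lam d t δ)
    (hη : ‖η‖ ≤ ρ) :
    inner ℝ (x t) (perturbed R S lam δ x r η t) - inner ℝ (x t) θstar
      ≤ (beta R S lam d t δ + beta R S lam d t δ * ρ) * ‖whiten (designMatrix lam x t) (x t)‖ := by
  have hβ := beta_nonneg (lam := lam) hR hS d t δ
  have h1 := (abs_le.1 (abs_inner_rlsEstimate_sub_le hlam hθ hr hconf (x t))).2
  rw [← beta_eq, inner_sub_right] at h1
  have h2 : inner ℝ (whiten (designMatrix lam x t) (x t)) η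
      ≤ ‖whiten (designMatrix lam x t) (x t)‖ * ρ :=
    (real_inner_le_norm _ _).trans (by gcongr)
  rw [inner_perturbed]
  nlinarith

end Pathwise

section Optimism

variable {Ω : Type*} {d : ℕ} {F1 : MeasurableSpace Ω}
  {θstar xstar : Vec d} {R S lam δ p c c' : ℝ} {T : ℕ} {x : ℕ → Ω → Vec d} {r ξ : ℕ → Ω → ℝ}
  {X : Set (Vec d)} {D : Measure (Vec d)}

/-- The norm `‖x_t‖_{V_t⁻¹}` of the arm played at step `t`. -/
def armNorm (lam : ℝ) (x : ℕ → Ω → Vec d) (t : ℕ) (ω : Ω) : ℝ :=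
  ‖whiten (designMatrix lam (fun s => x s ω) t) (x t ω)‖

/-- The confidence event at step `t`. -/
def confEvent (R lam δ : ℝ) (x : ℕ → Ω → Vec d) (ξ : ℕ → Ω → ℝ) (t : ℕ) : Set Ω :=
  {ω | ‖whiten (designMatrix lam (fun s => x s ω) t)
    (noiseSum (fun s => x s ω) (fun s => ξ s ω) t)‖ ≤ noiseRadius R lam d t δ}

lemma armNorm_nonneg (lam : ℝ) (x : ℕ → Ω → Vec d) (t : ℕ) (ω : Ω) : 0 ≤ armNorm lam x t ω :=
  norm_nonneg _

lemma armNorm_le (hlam : 0 < lam) {t : ℕ} {ω : Ω} (hx : ‖x t ω‖ ≤ 1) :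
    armNorm lam x t ω ≤ 1 / √lam :=
  (norm_whiten_designMatrix_le hlam _ _ _).trans (by gcongr)

lemma measurable_history_armNorm (hlam : 0 < lam) {t : ℕ} (ht : 1 ≤ t) :
    Measurable[history F1 x r (t + 1)] (armNorm lam x t) :=
  measurable_norm_comp (measurable_whiten_designMatrix hlam
    (fun s hs => measurable_history_arm (by simp at hs ⊢; omega))
    (measurable_history_arm (by simp; omega)))

lemma measurableSet_history_confEvent [mΩ : MeasurableSpace Ω] {μ : Measure Ω}
    (h : IsLinearBandit F1 μ θstar R T x r ξ) (hlam : 0 < lam)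
    {t : ℕ} (hT : t ≤ T + 1) : MeasurableSet[history F1 x r t] (confEvent R lam δ x ξ t) :=
  measurableSet_le (measurable_norm_comp (measurable_whiten_designMatrix hlam
    (fun _ hs => measurable_history_arm hs) (h.measurable_history_noiseSum hT))) measurable_const

lemma measurable_history_perturbed (hlam : 0 < lam) (t : ℕ) (e : Vec d) :
    Measurable[history F1 x r t] fun ω =>
      perturbed R S lam δ (fun s => x s ω) (fun s => r s ω) e t := by
  simp only [perturbed_eq]
  have h : Measurable[history F1 x r t] fun ω => whiten (designMatrix lam (fun s => x s ω) t) e :=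
    measurable_whiten_designMatrix hlam (fun _ hs => measurable_history_arm hs) measurable_const
  exact (measurable_rlsEstimate lam (fun _ hs => measurable_history_arm hs)
    (fun _ hs => measurable_history_reward hs)).add (h.const_smul (beta R S lam d t δ))

lemma continuous_perturbed (R S lam δ : ℝ) (x : ℕ → Vec d) (r : ℕ → ℝ) (t : ℕ) :
    Continuous fun e => perturbed R S lam δ x r e t := by
  have h : Continuous (whiten (designMatrix lam x t)) := LinearMap.continuous_of_finiteDimensional _
  simp only [perturbed_eq]
  exact continuous_const.add (h.const_smul (beta R S lam d t δ))

variable [mΩ : MeasurableSpace Ω] {μ : Measure Ω}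

/-- The regret of the sampled parameter is controlled by the conditional expectation of the norm
of the played arm, since optimistic samples have conditional probability at least `p / 2`. -/
lemma ae_optValue_sub_inner_perturbed_le [IsProbabilityMeasure μ]
    (hX : ∀ y ∈ X, ‖y‖ ≤ 1) (hR : 0 ≤ R) (hS : 0 ≤ S)
    (hlam : 1 ≤ lam) (hθ : ‖θstar‖ ≤ S) (hopt : IsOptimalArm X θstar xstar)
    (h : IsLinearBandit F1 μ θstar R T x r ξ) (hF : F1 ≤ mΩ) (hD : IsTSDistribution D p c c')
    (hd : 1 ≤ d) {δ' : ℝ} (hδ0 : 0 < δ') (hδ1 : δ' < 1) (hδp : δ' ≤ p / 2) {t : ℕ} (h1 : 1 ≤ t)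
    (hT : t ≤ T) {ηt : Ω → Vec d} (hη : Measurable ηt) (hlaw : μ.map ηt = D)
    (hind : Indep (MeasurableSpace.comap ηt inferInstance) (history F1 x r t) μ)
    (harm : ∀ ω, IsOptimalArm X (perturbed R S lam δ' (fun s => x s ω) (fun s => r s ω) (ηt ω) t)
      (x t ω)) :
    ∀ᵐ ω ∂μ, ω ∈ confEvent R lam δ' x ξ t → ‖ηt ω‖ ≤ √(c * d * Real.log (c' * d / δ')) →
      optValue X θstar
        - inner ℝ (x t ω) (perturbed R S lam δ' (fun s => x s ω) (fun s => r s ω) (ηt ω) t)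
      ≤ 4 * gamma R S lam c c' d t δ' / p * (μ[armNorm lam x t | history F1 x r t]) ω := by
  have hlam0 : 0 < lam := by linarith
  have hDp := hD.isProbabilityMeasure
  have hp := hD.p_pos
  have hm : history F1 x r t ≤ mΩ := h.history_le hF (by omega)
  set ρ := √(c * d * Real.log (c' * d / δ')) with hρdef
  have hρ : 0 ≤ ρ := Real.sqrt_nonneg _
  set β := beta R S lam d t δ' with hβdef
  have hβ : 0 ≤ β := beta_nonneg hR hS d t δ'
  have hr : ∀ ω, ∀ s ∈ Finset.Ico 1 t, r (s + 1) ω = inner ℝ (x s ω) θstar + ξ (s + 1) ω :=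
    fun ω s hs => by
      rw [Finset.mem_Ico] at hs
      exact h.reward_eq s hs.1 (by omega) ω
  set P : Vec d → Ω → Vec d := fun e ω =>
    perturbed R S lam δ' (fun s => x s ω) (fun s => r s ω) e t with hP
  have hJ : Continuous (optValue X) := (lipschitzWith_optValue hX ⟨xstar, hopt.1⟩).continuous
  -- The infimum over the ball removes the dependence on the fresh sample: `G` is
  -- history-measurable, yet dominates the gap of every sample in the ball.
  set G : Ω → ℝ := fun ω => optValue X θstar - ⨅ i, optValue X (P (ballSeq d hρ i) ω) with hG
  have hGm : Measurable[history F1 x r t] G :=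
    measurable_const.sub (Measurable.iInf fun i =>
      hJ.measurable.comp (measurable_history_perturbed hlam0 t _))
  have hbdd : ∀ ω, BddBelow (Set.range fun i => optValue X (P (ballSeq d hρ i) ω)) := by
    intro ω
    have hcompact : IsCompact (Metric.closedBall (0 : Vec d) ρ) := isCompact_closedBall 0 ρ
    refine (hcompact.bddBelow_image (f := fun e => optValue X (P e ω))
      (hJ.comp (continuous_perturbed _ _ _ _ _ _ _)).continuousOn).mono ?_
    rintro _ ⟨i, rfl⟩
    exact ⟨_, mem_closedBall_zero_iff.2 (norm_ballSeq_le hρ i), rfl⟩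
  set K : ℝ := β + β * ρ with hK
  have hK0 : 0 ≤ K := by positivity
  set E := confEvent R lam δ' x ξ t with hE
  have hEm : MeasurableSet[history F1 x r t] E := measurableSet_history_confEvent h hlam0 (by omega)
  set f : Ω → ℝ := E.indicator fun ω => min (max (G ω) 0) K with hf
  have hfm : Measurable[history F1 x r t] f :=
    ((hGm.max measurable_const).min measurable_const).indicator hEm
  have hf0 : ∀ ω, 0 ≤ f ω := fun ω =>
    Set.indicator_nonneg (fun ω _ => le_min (le_max_right _ _) hK0) ω
  have hfK : ∀ ω, f ω ≤ K := fun ω => Set.indicator_le' (fun ω _ => min_le_right _ _)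
    (fun _ _ => hK0) ω
  have hfi : Integrable f μ := Integrable.of_bound (hfm.mono hm le_rfl).aestronglyMeasurable K
    (ae_of_all _ fun ω => by rw [Real.norm_of_nonneg (hf0 ω)]; exact hfK ω)
  set y := armNorm lam x t with hy
  have hy0 : ∀ ω, 0 ≤ y ω := armNorm_nonneg lam x t
  have hym : Measurable y := (measurable_history_armNorm (F1 := F1) (r := r) hlam0 h1).mono
    (h.history_le hF (by omega)) le_rfl
  have hyB : ∀ ω, y ω ≤ 1 / √lam := fun ω => armNorm_le hlam0 (hX _ (harm ω).1)
  have hyi : Integrable y μ := Integrable.of_bound hym.aestronglyMeasurable (1 / √lam)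
    (ae_of_all _ fun ω => by rw [Real.norm_of_nonneg (hy0 ω)]; exact hyB ω)
  let Q : Set (Vec d × Vec d) := {z | ‖z.2‖ ≤ ρ ∧ ‖z.1‖ ≤ inner ℝ z.1 z.2}
  have hQ : MeasurableSet Q :=
    (measurableSet_le measurable_snd.norm measurable_const).inter
      (measurableSet_le measurable_fst.norm (measurable_fst.inner measurable_snd))
  set v : Ω → Vec d := fun ω => whiten (designMatrix lam (fun s => x s ω) t) xstar with hv
  have hvm : Measurable[history F1 x r t] v :=
    measurable_whiten_designMatrix hlam0 (fun _ hs => measurable_history_arm hs) measurable_const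
  -- On optimistic samples the pathwise bound holds against every perturbation in the ball, hence
  -- against the infimum in `G`.
  have hpoint : ∀ ω, ENNReal.ofReal (f ω) * Q.indicator 1 (v ω, ηt ω)
      ≤ ENNReal.ofReal (2 * (β * ρ) * y ω) := by
    intro ω
    by_cases hωQ : (v ω, ηt ω) ∈ Q
    · rw [Set.indicator_of_mem hωQ, Pi.one_apply, mul_one]
      refine ENNReal.ofReal_le_ofReal ?_
      have hrhs : 0 ≤ 2 * (β * ρ) * y ω := by have := hy0 ω; positivity
      by_cases hωE : ω ∈ E
      · rw [hf, Set.indicator_of_mem hωE]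
        refine (min_le_left _ _).trans (max_le ?_ hrhs)
        rw [hG, sub_le_comm]
        refine le_ciInf fun i => ?_
        rw [sub_le_comm]
        exact optValue_sub_optValue_perturbed_le hX hR hS hlam0 hθ hopt (hr ω) hωE (harm ω) hωQ.1
          hωQ.2 (norm_ballSeq_le hρ i)
      · rw [hf, Set.indicator_of_notMem hωE]; exact hrhs
    · rw [Set.indicator_of_notMem hωQ, mul_zero]; exact zero_le
  have hq : ∀ u, ENNReal.ofReal (p / 2) ≤ D {e | (u, e) ∈ Q} := by
    intro u
    rw [← ofReal_measureReal (measure_ne_top D _)]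
    refine ENNReal.ofReal_le_ofReal ?_
    have := hD.le_measureReal_optimistic hd hδ0 hδ1 u
    exact le_trans (by linarith) this
  -- Freezing gives `(p/2)∫_A f ≤ ∫_A f 1_Q`, and the pointwise bound gives `∫_A f 1_Q ≤ ∫_A 2βρ y`.
  -- Since `A` is a history set, `y` may be replaced by its conditional expectation.
  have hset : ∀ A, MeasurableSet[history F1 x r t] A →
      ∫ ω in A, p / 2 * f ω ∂μ
        ≤ ∫ ω in A, 2 * (β * ρ) * (μ[y | history F1 x r t]) ω ∂μ := by
    intro A hA
    have hAΩ : MeasurableSet A := hm A hA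
    have e2 : ∫ ω in A, 2 * (β * ρ) * (μ[y | history F1 x r t]) ω ∂μ
        = ∫ ω in A, 2 * (β * ρ) * y ω ∂μ := by
      rw [integral_const_mul, integral_const_mul, setIntegral_condExp hm hyi hA]
    rw [e2, ← ENNReal.ofReal_le_ofReal_iff (integral_nonneg fun ω => by
        have := hy0 ω; positivity),
      ofReal_integral_eq_lintegral_ofReal (hfi.const_mul _).integrableOn
        (ae_of_all _ fun ω => by have := hf0 ω; positivity),
      ofReal_integral_eq_lintegral_ofReal (hyi.const_mul _).integrableOn
        (ae_of_all _ fun ω => by have := hy0 ω; positivity)]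
    have hfreeze := lintegral_mul_indicator_ge hm hη hlaw hind hvm
      (hfm.ennreal_ofReal.indicator hA) hQ hq
    calc ∫⁻ ω in A, ENNReal.ofReal (p / 2 * f ω) ∂μ
        = ENNReal.ofReal (p / 2) * ∫⁻ ω, A.indicator (fun ω => ENNReal.ofReal (f ω)) ω ∂μ := by
          rw [lintegral_indicator hAΩ, ← lintegral_const_mul _ (hfm.mono hm le_rfl).ennreal_ofReal]
          refine lintegral_congr fun ω => ?_
          rw [ENNReal.ofReal_mul (by positivity)]
      _ ≤ _ := hfreeze
      _ ≤ ∫⁻ ω, A.indicator (fun ω => ENNReal.ofReal (2 * (β * ρ) * y ω)) ω ∂μ := by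
          refine lintegral_mono fun ω => ?_
          by_cases hωA : ω ∈ A
          · simpa only [Set.indicator_of_mem hωA] using hpoint ω
          · simp [Set.indicator_of_notMem hωA]
      _ = _ := lintegral_indicator hAΩ _
  have hae := ae_le_of_forall_setIntegral_le_of_measurable hm (hfm.const_mul (p / 2)).stronglyMeasurable
    (stronglyMeasurable_condExp.const_mul (2 * (β * ρ))) (hfi.const_mul _)
    (integrable_condExp.const_mul _) hset
  filter_upwards [hae] with ω hω hωE hωη
  have hle : optValue X θstar - inner ℝ (x t ω) (P (ηt ω) ω) ≤ f ω := by
    rw [hf, Set.indicator_of_mem hωE]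
    refine le_min (le_max_of_le_left ?_)
      (optValue_sub_inner_perturbed_le hX hR hS hlam hθ hopt (hr ω) hωE (harm ω) hωη)
    have hinf := ciInf_ballSeq_le hρ (f := fun e => optValue X (P e ω))
      (hJ.comp (continuous_perturbed _ _ _ _ _ _ _)) (hbdd ω) hωη
    simp only [(harm ω).optValue_eq hX, hP] at hinf
    simp only [hG, hP]
    linarith
  refine hle.trans ?_
  rw [gamma_eq, ← hβdef, ← hρdef]
  -- The constant `4γ/p` is `2/p` from the optimism probability times `2βρ` from the diameter of the
  -- ball.
  have : f ω = 2 / p * (p / 2 * f ω) := by field_simp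
  rw [this]
  calc _ ≤ 2 / p * (2 * (β * ρ) * (μ[y | history F1 x r t]) ω) := by gcongr
    _ = _ := by ring

end Optimism
end LinTS
end

/-! ### The degenerate regime `δ' > p/2`, and assembly of the high-probability bound. -/

noncomputable section
namespace LinTS
open Filter Topology

namespace IsTSDistribution

variable {d : ℕ} {D : Measure (Vec d)} {p c c' : ℝ}

/-- If `c'd < ε < 1`, the concentration radius at level `ε` is zero, so the origin would carry
positive mass, contradicting absolute continuity. -/
lemma one_le_mul_dim (h : IsTSDistribution D p c c') (hd : 1 ≤ d) : 1 ≤ c' * d := by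
  have := h.isProbabilityMeasure
  have : Nonempty (Fin d) := ⟨⟨0, hd⟩⟩
  have hd0 : (0:ℝ) < d := by exact_mod_cast hd
  have hc' := h.c'_pos
  refine le_of_forall_lt fun ε hε => ?_
  rcases le_or_gt ε 0 with hε0 | hε0
  · exact hε0.trans_lt (by positivity)
  by_contra hcon
  push Not at hcon
  have hlog : Real.log (c' * d / ε) ≤ 0 :=
    Real.log_nonpos (by positivity) ((div_le_one hε0).2 hcon)
  have hs : √(c * d * Real.log (c' * d / ε)) = 0 :=
    Real.sqrt_eq_zero_of_nonpos (mul_nonpos_of_nonneg_of_nonpos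
      (mul_nonneg h.c_pos.le hd0.le) hlog)
  have h1 := h.concentration ε hε0 hε
  rw [hs] at h1
  have e : {η : Vec d | ‖η‖ ≤ 0} = {0} := by ext η; simp
  have h2 : D {(0 : Vec d)} = 0 := h.absolutelyContinuous (measure_singleton 0)
  rw [e, measureReal_def, h2] at h1
  simp at h1
  linarith

/-- The concentration radius cannot be small where the anti-concentration probability is. -/
lemma one_le_radius_sq (h : IsTSDistribution D p c c') (hd : 1 ≤ d) :
    1 ≤ c * d * Real.log (2 * (c' * d) / p) := by
  have := h.isProbabilityMeasure
  have hp := h.p_pos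
  have hp1 := h.p_le_one hd
  have hu : ‖(EuclideanSpace.single (⟨0, hd⟩ : Fin d) (1:ℝ) : Vec d)‖ = 1 := by simp
  set u : Vec d := EuclideanSpace.single (⟨0, hd⟩ : Fin d) (1:ℝ)
  have h1 := h.anti_concentration u hu
  -- At level `p/2` the ball and the half-space have total mass at least `1 + p/2`, so they cannot
  -- be disjoint.
  have h2 := h.concentration (p / 2) (by linarith) (by linarith)
  rw [show c' * d / (p / 2) = 2 * (c' * d) / p by field_simp] at h2
  by_contra hcon
  push Not at hcon
  have hdisj : Disjoint {η : Vec d | ‖η‖ ≤ √(c * d * Real.log (2 * (c' * d) / p))}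
      {η : Vec d | 1 ≤ inner ℝ u η} := by
    rw [Set.disjoint_left]
    intro η (ha : ‖η‖ ≤ _) (hb : 1 ≤ inner ℝ u η)
    have h3 := real_inner_le_norm u η
    rw [hu, one_mul] at h3
    have h4 : √(c * d * Real.log (2 * (c' * d) / p)) < 1 := by
      rw [Real.sqrt_lt' one_pos]; simpa using hcon
    linarith
  have h5 : D.real ({η : Vec d | ‖η‖ ≤ √(c * d * Real.log (2 * (c' * d) / p))}
      ∪ {η : Vec d | 1 ≤ inner ℝ u η}) ≤ 1 := measureReal_le_one
  rw [measureReal_union hdisj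
    (measurableSet_le measurable_const (measurable_const.inner measurable_id))] at h5
  linarith

/-- Put `a = c'd ≥ 1`. As `δ ≤ 1/4`, `log(a/δ) ≥ log a + 1 ≥ p(log a + 1/p) ≥ p log(2a/p)`, and
`one_le_radius_sq` bounds the last logarithm below. It keeps `gamma` away from zero in the
degenerate regime. -/
lemma le_radius_sq (h : IsTSDistribution D p c c') (hd : 1 ≤ d) {δ : ℝ} (h0 : 0 < δ)
    (h1 : δ ≤ 1 / 4) : p ≤ c * d * Real.log (c' * d / δ) := by
  have ha := h.one_le_mul_dim hd
  have hr := h.one_le_radius_sq hd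
  have hp := h.p_pos
  have hp1 := h.p_le_one hd
  have hd0 : (0:ℝ) < d := by exact_mod_cast hd
  have hcd : 0 < c * d := mul_pos h.c_pos hd0
  set a := c' * d
  have ha0 : 0 < a := by linarith
  have hL : 0 ≤ Real.log a := Real.log_nonneg ha
  have hlog4 : 1 ≤ Real.log 4 := by
    rw [Real.le_log_iff_exp_le (by norm_num)]
    linarith [Real.exp_one_lt_d9]
  have e1 : Real.log (a / δ) ≥ Real.log a + 1 := by
    rw [Real.log_div ha0.ne' h0.ne']
    have h2 : Real.log δ ≤ Real.log (1 / 4) := Real.log_le_log h0 h1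
    rw [one_div, Real.log_inv] at h2
    linarith
  have e2 : Real.log (2 * a / p) ≤ Real.log a + 1 / p := by
    rw [mul_div_right_comm, Real.log_mul (by positivity) ha0.ne']
    have : Real.log (2 / p) ≤ Real.log 2 + (1 / p - 1) := by
      rw [Real.log_div (by norm_num) hp.ne', sub_eq_add_neg, ← Real.log_inv, ← one_div]
      gcongr
      exact Real.log_le_sub_one_of_pos (by positivity)
    linarith [Real.log_two_lt_d9]
  have e3 : p * Real.log (2 * a / p) ≤ Real.log (a / δ) := by
    have : p * (Real.log a + 1 / p) = p * Real.log a + 1 := by field_simp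
    nlinarith
  calc p = p * 1 := (mul_one p).symm
    _ ≤ p * (c * d * Real.log (2 * a / p)) := by gcongr
    _ = c * d * (p * Real.log (2 * a / p)) := by ring
    _ ≤ _ := by gcongr

end IsTSDistribution

section Crude

variable {d : ℕ} {X : Set (Vec d)} {R S lam p c c' : ℝ} {θstar xstar : Vec d}

lemma regret_le_crude (hX : ∀ y ∈ X, ‖y‖ ≤ 1) (hθ : ‖θstar‖ ≤ S) (hxs : xstar ∈ X)
    {x : ℕ → Vec d} {T : ℕ} (hx : ∀ t ∈ Finset.Icc 1 T, x t ∈ X) :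
    regret θstar xstar x T ≤ 2 * T * S := by
  have h : ∀ t ∈ Finset.Icc 1 T, inner ℝ xstar θstar - inner ℝ (x t) θstar ≤ 2 * S := by
    intro t ht
    rw [← inner_sub_left]
    refine (real_inner_le_norm _ _).trans ?_
    have h1 : ‖xstar - x t‖ ≤ 2 := (norm_sub_le _ _).trans
      (by linarith [hX _ hxs, hX _ (hx t ht)])
    gcongr
  refine (Finset.sum_le_sum h).trans (le_of_eq ?_)
  simp; ring

/-- Here `2Tp ≤ 4Tδ' = δ ≤ 1`, so `√(8pT) ≥ 4Tp`. With `γ ≥ √λ S √p` and `log(4/δ) ≥ 1`, the last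
term of the bound alone exceeds `2TS`. -/
lemma crude_le_regretBound {D : Measure (Vec d)} (hR : 0 ≤ R) (hS : 0 ≤ S) (hlam : 1 ≤ lam)
    (hD : IsTSDistribution D p c c') (hd : 1 ≤ d) {T : ℕ} (hT : 1 ≤ T) {δ : ℝ} (h0 : 0 < δ)
    (h1 : δ < 1) (hδp : p / 2 < δ / (4 * T)) :
    2 * T * S ≤ regretBound R S lam p c c' d T δ := by
  have hp := hD.p_pos
  have hT1 : (1:ℝ) ≤ T := by exact_mod_cast hT
  have hT0 : (0:ℝ) < T := by linarith
  have hlam0 : 0 < lam := by linarith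
  set δ' := δ / (4 * T) with hδ'
  have hδ'0 : 0 < δ' := by positivity
  have hδ'1 : δ' ≤ 1 / 4 := by
    rw [hδ', div_le_div_iff₀ (by positivity) (by norm_num)]; nlinarith
  have hβ0 := beta_nonneg (lam := lam) hR hS d T δ'
  have hβ : √lam * S ≤ beta R S lam d T δ' :=
    le_add_of_nonneg_left (noiseRadius_nonneg (lam := lam) hR d T δ')
  have hγ : √lam * S * √p ≤ gamma R S lam c c' d T δ' := by
    rw [gamma_eq]
    gcongr
    exact hD.le_radius_sq hd hδ'0 hδ'1
  have hγ0 : 0 ≤ gamma R S lam c c' d T δ' := le_trans (by positivity) hγ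
  have hTp : 2 * T * p ≤ 1 := by
    have : 2 * T * p < 4 * T * δ' := by nlinarith
    rw [hδ', mul_div_cancel₀ _ (by positivity)] at this
    linarith
  have hlog : 1 ≤ Real.log (4 / δ) := by
    rw [Real.le_log_iff_exp_le (by positivity), le_div_iff₀ h0]
    nlinarith [Real.exp_one_lt_d9, Real.exp_pos 1]
  have hsq : √(8 * T / lam * 1) ≤ √(8 * T / lam * Real.log (4 / δ)) := by
    gcongr
  have hprod : √lam * √p * √(8 * T / lam * 1) = √(p * (8 * T)) := by
    rw [← Real.sqrt_mul hlam0.le, ← Real.sqrt_mul (by positivity)]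
    congr 1; field_simp
  have hpT : 4 * T * p ≤ √(p * (8 * T)) := by
    refine Real.le_sqrt_of_sq_le ?_
    nlinarith [mul_pos hT0 hp]
  have hmain : 2 * T * S ≤ 4 * gamma R S lam c c' d T δ' / p * √(8 * T / lam * Real.log (4 / δ)) := by
    calc 2 * T * S ≤ 4 * (S * (4 * T * p)) / p := by
          rw [le_div_iff₀ hp]
          have : 0 ≤ T * S * p := by positivity
          linarith
      _ ≤ 4 * (S * √(p * (8 * T))) / p := by gcongr
      _ = 4 * (√lam * S * √p) / p * √(8 * T / lam * 1) := by rw [← hprod]; ring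
      _ ≤ _ := by gcongr
  have hrest : 0 ≤ (beta R S lam d T δ' + gamma R S lam c c' d T δ' * (1 + 4 / p))
      * √(2 * T * d * Real.log (1 + T / lam)) := by positivity
  unfold regretBound
  linarith

end Crude

section Main

variable {Ω : Type*} {d : ℕ} {F1 : MeasurableSpace Ω} [mΩ : MeasurableSpace Ω] {μ : Measure Ω}
  {θstar xstar : Vec d} {R S lam δ p c c' : ℝ} {T : ℕ} {x : ℕ → Ω → Vec d} {r ξ : ℕ → Ω → ℝ}
  {X : Set (Vec d)} {D : Measure (Vec d)} {η : ℕ → Ω → Vec d}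

/-- Deterministic on the good event: the optimism and prediction bounds are summed, and the
conditional expectations are traded for the norms themselves plus the compensated sum. -/
lemma regret_le_of_good (hX : ∀ y ∈ X, ‖y‖ ≤ 1) (hR : 0 ≤ R) (hS : 0 ≤ S)
    (hlam : 1 ≤ lam) (hp : 0 < p) (hT : 1 ≤ T) (hδ0 : 0 < δ) (hδ1 : δ < 1) (hθ : ‖θstar‖ ≤ S)
    (hopt : IsOptimalArm X θstar xstar)
    (h : IsLinearBandit F1 μ θstar R T x r ξ)
    {ω : Ω} (hx : ∀ t ∈ Finset.Icc 1 T, x t ω ∈ X)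
    (hconf : ∀ t ∈ Finset.Icc 1 T, ω ∈ confEvent R lam (δ / (4 * T)) x ξ t)
    (hη : ∀ t ∈ Finset.Icc 1 T, ‖η t ω‖ ≤ √(c * d * Real.log (c' * d / (δ / (4 * T)))))
    (hcomp : compensatedSum μ (history F1 x r) (armNorm lam x) T ω
      < 1 / √lam * √(2 * T * Real.log (1 / (δ / 4))))
    (hce : ∀ t ∈ Finset.Icc 1 T, 0 ≤ (μ[armNorm lam x t | history F1 x r t]) ω)
    (hgap : ∀ t ∈ Finset.Icc 1 T, optValue X θstar - inner ℝ (x t ω)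
        (perturbed R S lam (δ / (4 * T)) (fun s => x s ω) (fun s => r s ω) (η t ω) t)
      ≤ 4 * gamma R S lam c c' d t (δ / (4 * T)) / p *
        (μ[armNorm lam x t | history F1 x r t]) ω) :
    regret θstar xstar (fun t => x t ω) T ≤ regretBound R S lam p c c' d T δ := by
  have hlam0 : 0 < lam := by linarith
  have hT0 : (0:ℝ) < T := by exact_mod_cast hT
  set δ' := δ / (4 * T)
  have hδ'0 : 0 < δ' := by positivity
  set ρ := √(c * d * Real.log (c' * d / δ')) with hρ
  have hβ := beta_nonneg (lam := lam) hR hS d T δ'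
  have hγeq : ∀ t, gamma R S lam c c' d t δ' = beta R S lam d t δ' * ρ := fun t => rfl
  set β := beta R S lam d T δ' with hβdef
  set γ := gamma R S lam c c' d T δ' with hγdef
  have hγ0 : 0 ≤ γ := by rw [hγdef, hγeq]; positivity
  have hstep : ∀ t ∈ Finset.Icc 1 T, inner ℝ xstar θstar - inner ℝ (x t ω) θstar
      ≤ 4 * γ / p * (μ[armNorm lam x t | history F1 x r t]) ω + (β + γ) * armNorm lam x t ω := by
    intro t ht
    have ht' := Finset.mem_Icc.1 ht
    have hβt : beta R S lam d t δ' ≤ β := beta_mono hR hlam0 d ht'.2 hδ'0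
    have hγt : gamma R S lam c c' d t δ' ≤ γ := by
      rw [hγdef, hγeq, hγeq]; gcongr
    have hr : ∀ s ∈ Finset.Ico 1 t, r (s + 1) ω = inner ℝ (x s ω) θstar + ξ (s + 1) ω :=
      fun s hs => by
        rw [Finset.mem_Ico] at hs
        exact h.reward_eq s hs.1 (by omega) ω
    have h1 := hgap t ht
    rw [hopt.optValue_eq hX] at h1
    have h2 := inner_perturbed_sub_le (S := S) (r := fun s => r s ω) (ξ := fun s => ξ s ω) hR hS hlam0 hθ hr (hconf t ht) (hη t ht)
    rw [← hγeq] at h2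
    have h3 : 4 * gamma R S lam c c' d t δ' / p * (μ[armNorm lam x t | history F1 x r t]) ω
        ≤ 4 * γ / p * (μ[armNorm lam x t | history F1 x r t]) ω := by
      have := hce t ht; gcongr
    have h4 : (beta R S lam d t δ' + gamma R S lam c c' d t δ') * armNorm lam x t ω
        ≤ (β + γ) * armNorm lam x t ω := by
      have := armNorm_nonneg lam x t ω; gcongr
    have h5 : (beta R S lam d t δ' + gamma R S lam c c' d t δ') *
        ‖whiten (designMatrix lam (fun s => x s ω) t) (x t ω)‖
        = (beta R S lam d t δ' + gamma R S lam c c' d t δ') * armNorm lam x t ω := rfl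
    linarith
  have hY : ∑ t ∈ Finset.Icc 1 T, armNorm lam x t ω ≤ √(2 * T * d * Real.log (1 + T / lam)) := by
    refine Real.le_sqrt_of_sq_le ?_
    have h1 := sq_sum_le_card_mul_sum_sq (s := Finset.Icc 1 T) (f := fun t => armNorm lam x t ω)
    have h2 := sum_norm_whiten_sq_le hlam (fun s => x s ω) T fun t ht => hX _ (hx t ht)
    simp only [Nat.card_Icc, Nat.add_sub_cancel] at h1
    refine h1.trans ?_
    calc _ ≤ (T : ℝ) * (2 * d * Real.log (1 + T / lam)) := by
          refine mul_le_mul_of_nonneg_left h2 hT0.le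
      _ = _ := by ring
  have hM : ∑ t ∈ Finset.Icc 1 T, (μ[armNorm lam x t | history F1 x r t]) ω
      = compensatedSum μ (history F1 x r) (armNorm lam x) T ω
        + ∑ t ∈ Finset.Icc 1 T, armNorm lam x t ω := by
    simp only [compensatedSum, Finset.sum_sub_distrib]; ring
  -- The increments are bounded by `1/√λ`, so Azuma yields `2T` under the root; the stated `8T`
  -- leaves slack.
  have hε : 1 / √lam * √(2 * T * Real.log (1 / (δ / 4))) ≤ √(8 * T / lam * Real.log (4 / δ)) := by
    rw [one_div, ← Real.sqrt_inv, ← Real.sqrt_mul (by positivity),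
      show 1 / (δ / 4) = 4 / δ by field_simp]
    have hlog : 0 ≤ Real.log (4 / δ) := Real.log_nonneg (by rw [le_div_iff₀ hδ0]; linarith)
    refine Real.sqrt_le_sqrt ?_
    rw [show lam⁻¹ * (2 * T * Real.log (4 / δ)) = 2 * T / lam * Real.log (4 / δ) by field_simp]
    gcongr
    norm_num
  have hsum : regret θstar xstar (fun t => x t ω) T
      ≤ 4 * γ / p * ∑ t ∈ Finset.Icc 1 T, (μ[armNorm lam x t | history F1 x r t]) ω
        + (β + γ) * ∑ t ∈ Finset.Icc 1 T, armNorm lam x t ω := by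
    rw [Finset.mul_sum, Finset.mul_sum, ← Finset.sum_add_distrib]
    exact Finset.sum_le_sum hstep
  rw [hM] at hsum
  have hfin : 4 * γ / p * (compensatedSum μ (history F1 x r) (armNorm lam x) T ω
        + ∑ t ∈ Finset.Icc 1 T, armNorm lam x t ω)
      ≤ 4 * γ / p * (√(8 * T / lam * Real.log (4 / δ)) + √(2 * T * d * Real.log (1 + T / lam))) := by
    gcongr
    exact hcomp.le.trans hε
  have hfin2 : (β + γ) * ∑ t ∈ Finset.Icc 1 T, armNorm lam x t ω
      ≤ (β + γ) * √(2 * T * d * Real.log (1 + T / lam)) := by gcongr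
  refine (hsum.trans (add_le_add hfin hfin2)).trans (le_of_eq ?_)
  unfold regretBound
  ring

/-- Only subadditivity is used, so the regret event need not be shown measurable. -/
lemma one_sub_le_measureReal_of_compl_subset [IsProbabilityMeasure μ] {A B : Set Ω} {q : ℝ}
    (h : Aᶜ ⊆ B) (hB : μ.real B ≤ q) : 1 - q ≤ μ.real A := by
  have h1 : μ.real (Set.univ : Set Ω) ≤ μ.real A + μ.real Aᶜ := by
    rw [← Set.union_compl_self A]; exact measureReal_union_le _ _
  have h2 := measureReal_mono (μ := μ) h
  rw [probReal_univ] at h1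
  linarith

/-- The regret bound when the failure level is small compared to the anti-concentration
probability. -/
lemma measureReal_regret_le_of_le [IsProbabilityMeasure μ] (hX : ∀ y ∈ X, ‖y‖ ≤ 1) (hR : 0 ≤ R)
    (hS : 0 ≤ S) (hlam : 1 ≤ lam) (hd : 1 ≤ d) (hT : 1 ≤ T) (hδ0 : 0 < δ) (hδ1 : δ < 1)
    (hδp : δ / (4 * T) ≤ p / 2) (hθ : ‖θstar‖ ≤ S)
    (hopt : IsOptimalArm X θstar xstar) (hD : IsTSDistribution D p c c') (hF : F1 ≤ mΩ)
    (h : IsLinearBandit F1 μ θstar R T x r ξ)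
    (hts : IsThompsonSampling F1 μ X D R S lam δ T x r η) :
    1 - δ ≤ μ.real {ω | regret θstar xstar (fun t => x t ω) T
      ≤ regretBound R S lam p c c' d T δ} := by
  have hlam0 : 0 < lam := by linarith
  have hT1 : (1:ℝ) ≤ T := by exact_mod_cast hT
  have hT0 : (0:ℝ) < T := by linarith
  have hDp := hD.isProbabilityMeasure
  set δ' := δ / (4 * T) with hδ'
  have hδ'0 : 0 < δ' := by positivity
  have hδ'1 : δ' < 1 := by
    rw [hδ', div_lt_one (by positivity)]; linarith
  have hxX : ∀ t, 1 ≤ t → t ≤ T → ∀ ω, x t ω ∈ X := fun t h1 h2 ω => (hts.arm_optimal t h1 h2 ω).1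
  set ρ := √(c * d * Real.log (c' * d / δ')) with hρ
  let A : ℕ → Set Ω := fun t => (confEvent R lam δ' x ξ t)ᶜ
  let B : ℕ → Set Ω := fun t => {ω | ρ < ‖η t ω‖}
  let C : Set Ω := {ω | 1 / √lam * √(2 * T * Real.log (1 / (δ / 4)))
    ≤ compensatedSum μ (history F1 x r) (armNorm lam x) T ω}
  have hA : ∀ t ∈ Finset.Icc 1 T, μ.real (A t) ≤ δ' := by
    intro t ht
    rw [Finset.mem_Icc] at ht
    refine ENNReal.toReal_le_of_le_ofReal hδ'0.le ?_
    have := measure_noiseRadius_lt_norm_le h hF hR hlam0 hδ'0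
      (fun t h1 h2 ω => hX _ (hxX t h1 h2 ω)) ht.1 ht.2
    refine le_trans (measure_mono fun ω hω => ?_) this
    simpa only [A, confEvent, Set.mem_compl_iff, Set.mem_ofPred_eq, not_le] using hω
  have hB : ∀ t ∈ Finset.Icc 1 T, μ.real (B t) ≤ δ' := by
    intro t ht
    rw [Finset.mem_Icc] at ht
    have hm : MeasurableSet {e : Vec d | ‖e‖ ≤ ρ} := measurableSet_le measurable_norm measurable_const
    have h1 : μ.real (B t) = D.real {e : Vec d | ‖e‖ ≤ ρ}ᶜ := by
      rw [← hts.law_sample t ht.1 ht.2,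
        map_measureReal_apply (hts.measurable_sample t ht.1 ht.2) hm.compl]
      congr 1
      ext ω; simp [B]
    rw [h1, probReal_compl_eq_one_sub hm]
    linarith [hD.concentration δ' hδ'0 hδ'1]
  have hC : μ.real C ≤ δ / 4 :=
    measure_compensatedSum_ge_le hT (fun _ _ => history_mono) (fun t ht => h.history_le hF ht)
      (fun t h1 _ => measurable_history_armNorm hlam0 h1) (by positivity)
      (fun t _ _ ω => armNorm_nonneg lam x t ω)
      (fun t h1 h2 ω => armNorm_le hlam0 (hX _ (hxX t h1 h2 ω))) (by positivity) (by linarith)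
  have hae : ∀ᵐ ω ∂μ, ∀ t ∈ Finset.Icc 1 T, (ω ∈ confEvent R lam δ' x ξ t → ‖η t ω‖ ≤ ρ →
      optValue X θstar
        - inner ℝ (x t ω) (perturbed R S lam δ' (fun s => x s ω) (fun s => r s ω) (η t ω) t)
      ≤ 4 * gamma R S lam c c' d t δ' / p * (μ[armNorm lam x t | history F1 x r t]) ω) ∧
      0 ≤ (μ[armNorm lam x t | history F1 x r t]) ω := by
    rw [Filter.eventually_all_finset]
    intro t ht
    rw [Finset.mem_Icc] at ht
    have h1 := ae_optValue_sub_inner_perturbed_le hX hR hS hlam hθ hopt h hF hD hd hδ'0 hδ'1 hδp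
      ht.1 ht.2 (hts.measurable_sample t ht.1 ht.2) (hts.law_sample t ht.1 ht.2)
      (hts.indep_sample t ht.1 ht.2) (hts.arm_optimal t ht.1 ht.2)
    have h2 : ∀ᵐ ω ∂μ, 0 ≤ (μ[armNorm lam x t | history F1 x r t]) ω :=
      condExp_nonneg (ae_of_all _ (armNorm_nonneg lam x t))
    filter_upwards [h1, h2] with ω a b using ⟨a, b⟩
  set N : Set Ω := {ω | ¬ ∀ t ∈ Finset.Icc 1 T, (ω ∈ confEvent R lam δ' x ξ t → ‖η t ω‖ ≤ ρ →
      optValue X θstar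
        - inner ℝ (x t ω) (perturbed R S lam δ' (fun s => x s ω) (fun s => r s ω) (η t ω) t)
      ≤ 4 * gamma R S lam c c' d t δ' / p * (μ[armNorm lam x t | history F1 x r t]) ω) ∧
      0 ≤ (μ[armNorm lam x t | history F1 x r t]) ω} with hN
  have hN0 : μ.real N = 0 := by rw [measureReal_def, ae_iff.1 hae]; simp
  -- The confidence, concentration and Azuma failures cost `δ/4` each, the first two by a union over
  -- `T` steps at level `δ/(4T)`; the exceptional null set is free.
  refine one_sub_le_measureReal_of_compl_subset
    (B := (⋃ t ∈ Finset.Icc 1 T, A t) ∪ (⋃ t ∈ Finset.Icc 1 T, B t) ∪ C ∪ N) ?_ ?_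
  · intro ω hω
    by_contra hcon
    simp only [Set.mem_union, Set.mem_iUnion, not_or, not_exists] at hcon
    obtain ⟨⟨⟨ha, hb⟩, hc⟩, hn⟩ := hcon
    have hn' := not_not.1 hn
    have ha' : ∀ t ∈ Finset.Icc 1 T, ω ∈ confEvent R lam δ' x ξ t := fun t ht => not_not.1 (ha t ht)
    have hb' : ∀ t ∈ Finset.Icc 1 T, ‖η t ω‖ ≤ ρ := fun t ht => not_lt.1 (hb t ht)
    refine hω (regret_le_of_good hX hR hS hlam hD.p_pos hT hδ0 hδ1 hθ hopt h
      (fun t ht => hxX t (Finset.mem_Icc.1 ht).1 (Finset.mem_Icc.1 ht).2 ω) ha' hb'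
      (not_le.1 hc) (fun t ht => (hn' t ht).2) fun t ht => (hn' t ht).1 (ha' t ht) (hb' t ht))
  · have hU : ∀ E : ℕ → Set Ω, (∀ t ∈ Finset.Icc 1 T, μ.real (E t) ≤ δ') →
        μ.real (⋃ t ∈ Finset.Icc 1 T, E t) ≤ δ / 4 := fun E hE => by
      refine (measureReal_biUnion_finset_le _ _).trans ((Finset.sum_le_sum hE).trans (le_of_eq ?_))
      simp [hδ']
      field_simp
    refine (measureReal_union_le _ _).trans ?_
    have h1 := measureReal_union_le (μ := μ)
      ((⋃ t ∈ Finset.Icc 1 T, A t) ∪ (⋃ t ∈ Finset.Icc 1 T, B t)) C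
    have h2 := measureReal_union_le (μ := μ) (⋃ t ∈ Finset.Icc 1 T, A t) (⋃ t ∈ Finset.Icc 1 T, B t)
    linarith [hU A hA, hU B hB]

end Main
end LinTS
end

/-! ### Order of the bound in `d`, `T` and `δ`. -/

noncomputable section
namespace LinTS

lemma regretBound_dim_zero (R S lam p c c' : ℝ) (T : ℕ) (δ : ℝ) :
    regretBound R S lam p c c' 0 T δ = 0 := by
  simp [regretBound, gamma]

/-- The regret bound is of order `d^{3/2} √T` up to logarithmic factors. -/
lemma exists_regretBound_le {R S lam p c : ℝ} (c' : ℝ) (hR : 0 ≤ R) (hS : 0 ≤ S) (hlam : 1 ≤ lam)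
    (hp : 0 < p) (hc : 0 < c) (hc' : 0 < c') :
    ∃ C : ℝ, 0 < C ∧ ∀ (d T : ℕ) (δ : ℝ), 1 ≤ d → 1 ≤ T → 0 < δ → δ < 1 →
      regretBound R S lam p c c' d T δ
        ≤ C * (d : ℝ) ^ (3 / 2 : ℝ) * √T * Real.log (Real.exp 1 * d * T / δ) ^ 2 := by
  have hlam0 : 0 < lam := by linarith
  set b := 3 * R + √lam * S with hb
  set g := √(c * (|Real.log c'| + 2)) with hg
  have hb0 : 0 ≤ b := by positivity
  have hg0 : 0 ≤ g := by positivity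
  -- The final `+ 1` only secures positivity, since `b` vanishes when `R = S = 0`.
  refine ⟨2 * b + 2 * b * g * (1 + 4 / p) + 16 * b * g / p + 1, by positivity, ?_⟩
  intro d T δ hd hT hδ0 hδ1
  have hd1 : (1:ℝ) ≤ d := by exact_mod_cast hd
  have hT1 : (1:ℝ) ≤ T := by exact_mod_cast hT
  have hd0 : (0:ℝ) < d := by linarith
  have hT0 : (0:ℝ) < T := by linarith
  set L := Real.log (Real.exp 1 * d * T / δ) with hL
  have hLexp : L = 1 + Real.log d + Real.log T - Real.log δ := by
    rw [hL, Real.log_div (by positivity) hδ0.ne', Real.log_mul (by positivity) hT0.ne',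
      Real.log_mul (by positivity) hd0.ne', Real.log_exp]
  have hld : 0 ≤ Real.log d := Real.log_nonneg hd1
  have hlT : 0 ≤ Real.log T := Real.log_nonneg hT1
  have hlδ : Real.log δ ≤ 0 := Real.log_nonpos hδ0.le hδ1.le
  have hl2 := Real.log_two_lt_d9
  have hl4 : Real.log 4 = 2 * Real.log 2 := by
    rw [show (4:ℝ) = 2 ^ 2 by norm_num, Real.log_pow]; norm_num
  have hL1 : 1 ≤ L := by linarith
  have hL0 : 0 < L := by linarith
  -- Everything is measured in `q ≥ 1`: `β ≤ bq`, `γ ≤ bgq²`, and both square roots are `O(√T q)`.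
  -- The leading term is `√T q³`, with `q³ = d^{3/2}L^{3/2} ≤ d^{3/2}L²`.
  set q := √(d * L) with hq
  have hq1 : 1 ≤ q := Real.one_le_sqrt.2 (by nlinarith)
  have hq0 : 0 ≤ q := by linarith
  have hq2 : q ^ 2 = d * L := Real.sq_sqrt (by positivity)
  have hratio : Real.log (1 + T / lam) ≤ L := by
    have h1 : (1:ℝ) + T / lam ≤ 2 * T := by
      have : (T:ℝ) / lam ≤ T := div_le_self hT0.le hlam
      linarith
    refine (Real.log_le_log (by positivity) h1).trans ?_
    rw [Real.log_mul (by norm_num) hT0.ne']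
    linarith
  set δ' := δ / (4 * T) with hδ'
  have hδ'0 : 0 < δ' := by positivity
  have hlδ' : Real.log δ' = Real.log δ - (Real.log 4 + Real.log T) := by
    rw [hδ', Real.log_div hδ0.ne' (by positivity), Real.log_mul (by norm_num) hT0.ne']
  have hβ : beta R S lam d T δ' ≤ b * q := by
    have h1 : 2 * Real.log ((lam + T) ^ ((d : ℝ) / 2) * lam ^ (-((d : ℝ) / 2)) / δ')
        ≤ 3 ^ 2 * (d * L) := by
      have h2 : Real.log (1 + T / lam) = Real.log (lam + T) - Real.log lam := by
        rw [← Real.log_div (by positivity) (by positivity)]; congr 1; field_simp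
      rw [Real.log_div (by positivity) hδ'0.ne', Real.log_mul (by positivity) (by positivity),
        Real.log_rpow (by positivity), Real.log_rpow (by positivity), hlδ']
      have h3 : (d:ℝ) * (Real.log (lam + T) - Real.log lam) ≤ d * L := by
        rw [← h2]; gcongr
      have h4 : L ≤ d * L := le_mul_of_one_le_left hL0.le hd1
      nlinarith
    have h2 : √(2 * Real.log ((lam + T) ^ ((d : ℝ) / 2) * lam ^ (-((d : ℝ) / 2)) / δ'))
        ≤ 3 * q := by
      refine (Real.sqrt_le_sqrt h1).trans (le_of_eq ?_)
      rw [Real.sqrt_mul (by positivity), Real.sqrt_sq (by norm_num)]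
    unfold beta
    calc _ ≤ R * (3 * q) + √lam * S * q :=
          add_le_add (mul_le_mul_of_nonneg_left h2 hR)
            (le_mul_of_one_le_right (by positivity) hq1)
      _ = b * q := by rw [hb]; ring
  have hγ : gamma R S lam c c' d T δ' ≤ b * g * q ^ 2 := by
    have h1 : √(c * d * Real.log (c' * d / δ')) ≤ g * q := by
      rw [hg, hq, ← Real.sqrt_mul (by positivity)]
      refine Real.sqrt_le_sqrt ?_
      have h2 : Real.log (c' * d / δ') ≤ (|Real.log c'| + 2) * L := by
        rw [Real.log_div (by positivity) hδ'0.ne', Real.log_mul hc'.ne' hd0.ne', hlδ']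
        have h3 := le_abs_self (Real.log c')
        have h4 : |Real.log c'| ≤ |Real.log c'| * L := le_mul_of_one_le_right (abs_nonneg _) hL1
        linarith
      calc c * d * Real.log (c' * d / δ') ≤ c * d * ((|Real.log c'| + 2) * L) := by gcongr
        _ = _ := by ring
    rw [gamma_eq]
    calc _ ≤ b * q * (g * q) := by gcongr
      _ = _ := by ring
  have hs1 : √(2 * T * d * Real.log (1 + T / lam)) ≤ 2 * √T * q := by
    calc _ ≤ √(2 ^ 2 * T * (d * L)) := by
          refine Real.sqrt_le_sqrt ?_
          calc 2 * T * d * Real.log (1 + T / lam) ≤ 2 * T * d * L := by gcongr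
            _ ≤ _ := by
              have : 0 ≤ T * d * L := by positivity
              linarith
      _ = _ := by
          rw [Real.sqrt_mul (by positivity), Real.sqrt_mul (by positivity),
            Real.sqrt_sq (by norm_num)]
  have hs2 : √(8 * T / lam * Real.log (4 / δ)) ≤ 4 * √T * q := by
    calc _ ≤ √(4 ^ 2 * T * (d * L)) := by
          refine Real.sqrt_le_sqrt ?_
          have h1 : Real.log (4 / δ) ≤ 2 * L := by
            rw [Real.log_div (by norm_num) hδ0.ne']
            linarith
          have h2 : 8 * T / lam ≤ 8 * (T:ℝ) := div_le_self (by positivity) hlam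
          have h3 : L ≤ d * L := le_mul_of_one_le_left hL0.le hd1
          calc 8 * T / lam * Real.log (4 / δ) ≤ 8 * T * (2 * (d * L)) := by
                refine mul_le_mul h2 (by linarith) (Real.log_nonneg ?_) (by positivity)
                rw [le_div_iff₀ hδ0]; linarith
            _ = _ := by ring
      _ = _ := by
          rw [Real.sqrt_mul (by positivity), Real.sqrt_mul (by positivity),
            Real.sqrt_sq (by norm_num)]
  have hq3 : q ^ 3 ≤ (d : ℝ) ^ (3 / 2 : ℝ) * L ^ 2 := by
    have h1 : (d : ℝ) ^ (3 / 2 : ℝ) = d * √d := by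
      rw [show (3 / 2 : ℝ) = 1 + 1 / 2 by norm_num, Real.rpow_add hd0, Real.rpow_one,
        Real.sqrt_eq_rpow]
    have h2 : √L ≤ L := Real.sqrt_le_iff.2 ⟨hL0.le, by nlinarith⟩
    rw [h1, pow_succ, hq2, hq, Real.sqrt_mul hd0.le]
    calc d * L * (√d * √L) ≤ d * L * (√d * L) := by gcongr
      _ = _ := by ring
  have hq13 : q ^ 2 ≤ q ^ 3 := pow_le_pow_right₀ hq1 (by norm_num)
  unfold regretBound
  calc _ ≤ (b * q + b * g * q ^ 2 * (1 + 4 / p)) * (2 * √T * q)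
        + 4 * (b * g * q ^ 2) / p * (4 * √T * q) := by gcongr
    _ = 2 * b * √T * q ^ 2 + (2 * b * g * (1 + 4 / p) + 16 * b * g / p) * √T * q ^ 3 := by ring
    _ ≤ 2 * b * √T * q ^ 3 + (2 * b * g * (1 + 4 / p) + 16 * b * g / p) * √T * q ^ 3 := by
        gcongr
    _ ≤ (2 * b + 2 * b * g * (1 + 4 / p) + 16 * b * g / p + 1) * √T * q ^ 3 := by
        have : 0 ≤ √T * q ^ 3 := by positivity
        linarith
    _ ≤ (2 * b + 2 * b * g * (1 + 4 / p) + 16 * b * g / p + 1) * √T *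
        ((d : ℝ) ^ (3 / 2 : ℝ) * L ^ 2) := by gcongr
    _ = _ := by ring

end LinTS
end

theorem theorem1 (R S lam p c c' : ℝ) (hR : 0 ≤ R) (hS : 0 ≤ S) (hlam : 1 ≤ lam)
    (hp : 0 < p) (hc : 0 < c) (hc' : 0 < c') :
    -- the high-probability regret bound
    (∀ (d T : ℕ) (_ : 1 ≤ T) (δ : ℝ) (_ : 0 < δ) (_ : δ < 1)
      (X : Set (LinTS.Vec d)) (_ : IsClosed X) (_ : ∀ y ∈ X, ‖y‖ ≤ 1)
      (θstar : LinTS.Vec d) (_ : ‖θstar‖ ≤ S)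
      (xstar : LinTS.Vec d) (_ : LinTS.IsOptimalArm X θstar xstar)
      (D : Measure (LinTS.Vec d)) (_ : LinTS.IsTSDistribution D p c c')
      (Ω : Type*) (F1 : MeasurableSpace Ω) (mΩ : MeasurableSpace Ω) (_ : F1 ≤ mΩ)
      (μ : Measure Ω) (_ : IsProbabilityMeasure μ)
      (x : ℕ → Ω → LinTS.Vec d) (r ξ : ℕ → Ω → ℝ) (η : ℕ → Ω → LinTS.Vec d)
      (_ : LinTS.IsLinearBandit F1 μ θstar R T x r ξ)
      (_ : LinTS.IsThompsonSampling F1 μ X D R S lam δ T x r η),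
      1 - δ ≤ μ.real {ω | LinTS.regret θstar xstar (fun t => x t ω) T
        ≤ LinTS.regretBound R S lam p c c' d T δ}) ∧
    -- the bound is of order `d^{3/2} √T` up to a power of `log (e d T / δ)`,
    -- with constants that depend only on `R, S, lam, p, c, c'`
    (∃ (C : ℝ) (k : ℕ), 0 < C ∧ ∀ (d T : ℕ) (δ : ℝ), 1 ≤ d → 1 ≤ T → 0 < δ → δ < 1 →
      LinTS.regretBound R S lam p c c' d T δ
        ≤ C * (d : ℝ) ^ (3 / 2 : ℝ) * Real.sqrt T
          * Real.log (Real.exp 1 * d * T / δ) ^ k) := by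
  refine ⟨?_, ?_⟩
  · intro d T hT δ hδ0 hδ1 X _ hX θstar hθ xstar hopt D hD Ω F1 mΩ hF μ hμ x r ξ η h hts
    -- Used where the bound holds surely: in dimension zero, where both sides vanish, and in the
    -- regime `δ' > p/2`.
    have hcrude : (∀ ω, LinTS.regret θstar xstar (fun t => x t ω) T
        ≤ LinTS.regretBound R S lam p c c' d T δ) →
        1 - δ ≤ μ.real {ω | LinTS.regret θstar xstar (fun t => x t ω) T
          ≤ LinTS.regretBound R S lam p c c' d T δ} := fun hall =>
      LinTS.one_sub_le_measureReal_of_compl_subset (B := ∅)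
        (fun ω hω => (hω (hall ω)).elim) (by simpa using hδ0.le)
    rcases Nat.eq_zero_or_pos d with rfl | hd
    · refine hcrude fun ω => ?_
      rw [LinTS.regretBound_dim_zero]
      refine le_of_eq (Finset.sum_eq_zero fun t _ => ?_)
      rw [Subsingleton.elim xstar (x t ω), sub_self]
    · rcases le_or_gt (δ / (4 * T)) (p / 2) with hδp | hδp
      · exact LinTS.measureReal_regret_le_of_le hX hR hS hlam hd hT hδ0 hδ1 hδp hθ hopt hD hF h hts
      · refine hcrude fun ω => ?_
        refine (LinTS.regret_le_crude hX hθ hopt.1 fun t ht => ?_).trans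
          (LinTS.crude_le_regretBound hR hS hlam hD hd hT hδ0 hδ1 hδp)
        rw [Finset.mem_Icc] at ht
        exact (hts.arm_optimal t ht.1 ht.2 ω).1
  · obtain ⟨C, hC, hle⟩ := LinTS.exists_regretBound_le c' hR hS hlam hp hc hc'
    exact ⟨C, 2, hC, hle⟩
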